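/- For a finite simple graph $G$ and a set $X\subseteq V(G)$, let $\mathrm{cl}(X)$ (resp. $\mathrm{ind}(X)$) say that $X$ is a clique (resp. an independent set), the empty set and singletons included. Let $\mathrm{maxcl}(X)$ say that $X$ is a clique and no vertex outside $X$ is adjacent to all vertices of $X$, and let $\mathrm{maxind}(X)$ say that $X$ is independent and every vertex outside $X$ is adjacent to some vertex of $X$. Let $\varphi_C(X)$ say that some vertex outside $X$ is adjacent to no vertex of $X$, and $\varphi_I(X)$ that some vertex outside $X$ is adjacent to every vertex of $X$. Consider the following sentences, in which $X$ ranges over all sets of vertices: $$\varphi^1_C=\forall X\,[\mathrm{cl}(X)\to\varphi_C(X)],\quad \varphi^2_C=\forall X\,[\mathrm{maxcl}(X)\to\neg\varphi_C(X)],\quad \varphi^3_C=\forall X\,[(\mathrm{cl}(X)\wedge\neg\varphi_C(X))\to\mathrm{maxcl}(X)],$$ $$\varphi^1_I=\forall X\,[\mathrm{ind}(X)\to\varphi_I(X)],\quad \varphi^2_I=\forall X\,[\mathrm{maxind}(X)\to\neg\varphi_I(X)],\quad \varphi^3_I=\forall X\,[(\mathrm{ind}(X)\wedge\neg\varphi_I(X))\to\mathrm{maxind}(X)].$$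 Let $p\in(0,1)$ be a constant, and let $G(n,p)$ be the random graph on $n$ labelled vertices in which each pair of vertices is joined by an edge independently with probability $p$. 1. If $p>\frac{3-\sqrt5}{2}$, then $\mathsf P(G(n,p)\models\neg\varphi^1_C\wedge\neg\varphi^2_C\wedge\neg\varphi^3_C)\to1$ as $n\to\infty$. 2. If $p<\frac{3-\sqrt5}{2}$, then $\mathsf P(G(n,p)\models\varphi^1_C)\to1$ as $n\to\infty$. 3. If $p=\frac{3-\sqrt5}{2}$, then $\mathsf P(G(n,p)\models\varphi^3_C)$ does not converge as $n\to\infty$. 4. If $p<\frac{\sqrt5-1}{2}$, then $\mathsf P(G(n,p)\models\neg\varphi^1_I\wedge\neg\varphi^2_I\wedge\neg\varphi^3_I)\to1$ as $n\to\infty$. 5. If $p>\frac{\sqrt5-1}{2}$, then $\mathsf P(G(n,p)\models\varphi^1_I)\to1$ as $n\to\infty$. 6. If $p=\frac{\sqrt5-1}{2}$, then $\mathsf P(G(n,p)\models\varphi^3_I)$ does not converge as $n\to\infty$. -/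

import Mathlib

namespace CliqueSentences

variable {V : Type*}

/-- `X` is a maximal clique: a clique such that no vertex outside `X` is adjacent to all of `X`. -/
def MaxCl (G : SimpleGraph V) (X : Set V) : Prop :=
  G.IsClique X ∧ ¬ ∃ x, x ∉ X ∧ ∀ y, y ∈ X → G.Adj x y

/-- `φ_C(X)`: some vertex outside `X` is not adjacent to any vertex of `X`. -/
def PhiC (G : SimpleGraph V) (X : Set V) : Prop :=
  ∃ x, x ∉ X ∧ ∀ y, y ∈ X → ¬ G.Adj x y

/-- `G ⊨ φ¹_C`. The monadic quantifier `∀ X` ranges over all sets of vertices. -/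
def PhiC1 (G : SimpleGraph V) : Prop :=
  ∀ X : Set V, G.IsClique X → PhiC G X

/-- `G ⊨ φ²_C`. -/
def PhiC2 (G : SimpleGraph V) : Prop :=
  ∀ X : Set V, MaxCl G X → ¬ PhiC G X

/-- `G ⊨ φ³_C`. -/
def PhiC3 (G : SimpleGraph V) : Prop :=
  ∀ X : Set V, G.IsClique X ∧ ¬ PhiC G X → MaxCl G X

/-- `X` is a maximal independent set: an independent set such that every vertex outside `X` has
a neighbour in `X`. -/
def MaxInd (G : SimpleGraph V) (X : Set V) : Prop :=
  G.IsIndepSet X ∧ ¬ ∃ x, x ∉ X ∧ ∀ y, y ∈ X → ¬ G.Adj x y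

/-- `φ_I(X)`: some vertex outside `X` is adjacent to every vertex of `X`. -/
def PhiI (G : SimpleGraph V) (X : Set V) : Prop :=
  ∃ x, x ∉ X ∧ ∀ y, y ∈ X → G.Adj x y

/-- `G ⊨ φ¹_I`. -/
def PhiI1 (G : SimpleGraph V) : Prop :=
  ∀ X : Set V, G.IsIndepSet X → PhiI G X

/-- `G ⊨ φ²_I`. -/
def PhiI2 (G : SimpleGraph V) : Prop :=
  ∀ X : Set V, MaxInd G X → ¬ PhiI G X

/-- `G ⊨ φ³_I`. -/
def PhiI3 (G : SimpleGraph V) : Prop :=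
  ∀ X : Set V, G.IsIndepSet X ∧ ¬ PhiI G X → MaxInd G X

/-- The probability that the binomial random graph `G(n, p)` on `n` labelled vertices has the
property `Q`. -/
noncomputable def prob (n : ℕ) (p : unitInterval) (Q : SimpleGraph (Fin n) → Prop) : ℝ :=
  (SimpleGraph.binomialRandom (Fin n) p).real {G | Q G}

end CliqueSentences

/-!
Passing to the complement graph exchanges the clique sentences with the independent set sentences
and `p` with `1 - p`, so only the clique sentences matter. Write `q = 1 - p`; on `(0, 1)` the
equation `p = q ^ 2` has the single root `(3 - √5) / 2`. A `k`-set is a clique with probability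
`p ^ (k choose 2)`, and the expected number of vertices without a neighbour in it is about
`y = n * q ^ k`.

* If `p < q ^ 2`, the expected number of cliques with a neighbour of every outside vertex tends
  to `0`.
* If `p > q ^ 2`, take `k = log_a n` for a base `a` such that `n * p ^ k` and `n * q ^ k` tend to
  `0` while `n * √p ^ k` grows like a power of `n`. For a fixed vertex `v`, a second moment
  computation over the `k`-cliques avoiding `v` finds, with high probability, one that is
  extended by `v` and contains a neighbour of every other vertex (refuting `φ³_C`, hence `φ¹_C`),
  and one that contains no neighbour of `v` and is extended by no other vertex (refuting `φ²_C`).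
* If `p = q ^ 2`, the expected number of counterexamples to `φ³_C` of size `k` is of order
  `y ^ (k + 1) * exp (-y) / k!`, which is negligible unless `y` is close to `k`. Along
  `n ≈ (m + 1) * q ^ (-m - 1/2)` this happens for no `k`, and `φ³_C` has probability tending to `1`.
  Along `n ≈ k * q ^ (-k)` the second moment method keeps the probability of a counterexample
  bounded away from `0`.
-/

namespace CliqueSentences

open MeasureTheory ProbabilityTheory Filter Topology
open scoped unitInterval SimpleGraph

section SecondMoment

variable {Ω ι : Type*} [MeasurableSpace Ω] {μ : Measure Ω}

lemma sq_integral_mul_le {f g : Ω → ℝ} (hf : MemLp f 2 μ) (hg : MemLp g 2 μ) :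
    (∫ x, f x * g x ∂μ) ^ 2 ≤ (∫ x, f x ^ 2 ∂μ) * ∫ x, g x ^ 2 ∂μ := by
  have hnonneg : ∀ t : ℝ, 0 ≤ (∫ x, f x ^ 2 ∂μ) * (t * t) + (2 * ∫ x, f x * g x ∂μ) * t +
      ∫ x, g x ^ 2 ∂μ := by
    intro t
    calc 0 ≤ ∫ x, (t * f x + g x) ^ 2 ∂μ := integral_nonneg fun x => sq_nonneg _
      _ = ∫ x, (t ^ 2 * f x ^ 2 + 2 * t * (f x * g x) + g x ^ 2) ∂μ := by
          congr with x
          ring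
      _ = t ^ 2 * (∫ x, f x ^ 2 ∂μ) + 2 * t * (∫ x, f x * g x ∂μ) + ∫ x, g x ^ 2 ∂μ := by
          have hff := hf.integrable_sq.const_mul (t ^ 2)
          have hfg : Integrable (fun x => 2 * t * (f x * g x)) μ :=
            (hf.integrable_mul hg).const_mul (2 * t)
          have hcross : Integrable (fun x => t ^ 2 * f x ^ 2 + 2 * t * (f x * g x)) μ :=
            hff.add hfg
          rw [integral_add hcross hg.integrable_sq, integral_add hff hfg,
            integral_const_mul, integral_const_mul]
      _ = _ := by ring
  have hdiscrim := discrim_le_zero hnonneg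
  rw [discrim] at hdiscrim
  linarith

variable [IsFiniteMeasure μ] {s : Finset ι} {A : ι → Set Ω}

lemma integral_sq_sum_indicator_one (hA : ∀ i ∈ s, MeasurableSet (A i)) :
    ∫ x, (∑ i ∈ s, (A i).indicator (1 : Ω → ℝ) x) ^ 2 ∂μ =
      ∑ i ∈ s, ∑ j ∈ s, μ.real (A i ∩ A j) := by
  have hintegral : ∀ i ∈ s, ∀ j ∈ s, Integrable ((A i ∩ A j).indicator (1 : Ω → ℝ)) μ :=
    fun i hi j hj => (integrable_const 1).indicator ((hA i hi).inter (hA j hj))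
  have hexpand : ∀ x, (∑ i ∈ s, (A i).indicator (1 : Ω → ℝ) x) ^ 2 =
      ∑ i ∈ s, ∑ j ∈ s, (A i ∩ A j).indicator 1 x := fun x => by
    simp only [sq, Finset.sum_mul_sum, Set.inter_indicator_one, Pi.mul_apply]
  simp only [hexpand]
  rw [integral_finsetSum s fun i hi => integrable_finsetSum s (hintegral i hi)]
  refine Finset.sum_congr rfl fun i hi => ?_
  rw [integral_finsetSum s (hintegral i hi)]
  exact Finset.sum_congr rfl fun j hj => integral_indicator_one ((hA i hi).inter (hA j hj))

-- Cauchy-Schwarz for the number of events that occur and the indicator of their union.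
lemma sq_sum_measureReal_le (hA : ∀ i ∈ s, MeasurableSet (A i)) :
    (∑ i ∈ s, μ.real (A i)) ^ 2 ≤
      μ.real (⋃ i ∈ s, A i) * ∑ i ∈ s, ∑ j ∈ s, μ.real (A i ∩ A j) := by
  set U := ⋃ i ∈ s, A i
  set count : Ω → ℝ := fun x => ∑ i ∈ s, (A i).indicator 1 x with hcount
  have hind : ∀ {B : Set Ω}, MeasurableSet B → MemLp (B.indicator (1 : Ω → ℝ)) 2 μ :=
    fun hB => (memLp_const (1 : ℝ)).indicator hB
  have hU : MeasurableSet U := s.measurableSet_biUnion hA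
  have hintegral : ∀ {B : Set Ω}, MeasurableSet B → Integrable (B.indicator (1 : Ω → ℝ)) μ :=
    fun hB => (integrable_const 1).indicator hB
  have hmul : ∀ x, U.indicator 1 x * count x = count x := by
    intro x
    by_cases hx : x ∈ U
    · simp [hx]
    · have hzero : count x = 0 := Finset.sum_eq_zero fun i hi =>
        Set.indicator_of_notMem (fun h => hx (Set.mem_biUnion hi h)) _
      simp [hzero]
  have hmean : ∫ x, U.indicator 1 x * count x ∂μ = ∑ i ∈ s, μ.real (A i) := by
    simp only [hmul]
    rw [hcount, integral_finsetSum s fun i hi => hintegral (hA i hi)]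
    exact Finset.sum_congr rfl fun i hi => integral_indicator_one (hA i hi)
  have hUsq : ∫ x, U.indicator (1 : Ω → ℝ) x ^ 2 ∂μ = μ.real U := by
    rw [← integral_indicator_one hU]
    congr with x
    by_cases hx : x ∈ U <;> simp [hx]
  rw [← hmean, ← integral_sq_sum_indicator_one hA, ← hUsq]
  exact sq_integral_mul_le (hind hU) (memLp_finsetSum s fun i hi => hind (hA i hi))

lemma one_le_mul_measureReal_biUnion {a K : ℝ} (hA : ∀ i ∈ s, MeasurableSet (A i))
    (hs : s.Nonempty) (ha : 0 < a) (hAa : ∀ i ∈ s, μ.real (A i) = a)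
    (hpair : ∀ i ∈ s, ∑ j ∈ s, μ.real (A i ∩ A j) ≤ K * (a ^ 2 * s.card)) :
    1 ≤ K * μ.real (⋃ i ∈ s, A i) := by
  have hcard : (0 : ℝ) < s.card := Nat.cast_pos.2 hs.card_pos
  have hsum : ∑ i ∈ s, ∑ j ∈ s, μ.real (A i ∩ A j) ≤ K * (s.card * a) ^ 2 :=
    (Finset.sum_le_card_nsmul s _ _ hpair).trans_eq (by rw [nsmul_eq_mul]; ring)
  have h := (sq_sum_measureReal_le hA).trans
    (mul_le_mul_of_nonneg_left hsum (measureReal_nonneg (μ := μ)))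
  rw [Finset.sum_congr rfl hAa, Finset.sum_const, nsmul_eq_mul] at h
  refine le_of_mul_le_mul_right ?_ (sq_pos_of_pos (mul_pos hcard ha))
  linarith

end SecondMoment

section RandomGraph

variable {V : Type*}

/-- The event that `e` is an edge. -/
def edgeEvent (e : Sym2 V) : Set (SimpleGraph V) := {G | e ∈ G.edgeSet}

/-- The σ-algebra of the events determined by the status of the pairs in `S`. -/
abbrev edgeSpace (S : Set (Sym2 V)) : MeasurableSpace (SimpleGraph V) :=
  ⨆ e ∈ S, MeasurableSpace.generateFrom {edgeEvent e}

lemma edgeSpace_mono {S T : Set (Sym2 V)} (h : S ⊆ T) : edgeSpace S ≤ edgeSpace T :=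
  biSup_mono h

lemma measurableSet_edgeSpace_edgeEvent {S : Set (Sym2 V)} {e : Sym2 V} (he : e ∈ S) :
    MeasurableSet[edgeSpace S] (edgeEvent e) :=
  le_biSup (fun e => MeasurableSpace.generateFrom {edgeEvent e}) he _
    (MeasurableSpace.measurableSet_generateFrom rfl)

lemma measurableSet_edgeEvent (e : Sym2 V) : MeasurableSet (edgeEvent e) :=
  SimpleGraph.measurable_edgeSet (measurableSet_setOfPred.2 (measurable_set_mem e))

/-- The event that the pairs in `F` all are edges (`b = true`) or all are non-edges
(`b = false`). -/
def statusEvent (b : Bool) (F : Finset (Sym2 V)) : Set (SimpleGraph V) :=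
  {G | ∀ e ∈ F, (e ∈ G.edgeSet ↔ b = true)}

lemma statusEvent_eq_biInter (b : Bool) (F : Finset (Sym2 V)) :
    statusEvent b F = ⋂ e ∈ F, bif b then edgeEvent e else (edgeEvent e)ᶜ := by
  cases b <;> ext G <;> simp [statusEvent, edgeEvent]

lemma measurableSet_statusEvent (b : Bool) (F : Finset (Sym2 V)) :
    MeasurableSet[edgeSpace (F : Set (Sym2 V))] (statusEvent b F) := by
  rw [statusEvent_eq_biInter]
  refine F.measurableSet_biInter fun e he => ?_
  cases b
  · exact (measurableSet_edgeSpace_edgeEvent he).compl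
  · exact measurableSet_edgeSpace_edgeEvent he

variable [Countable V] (p : I)

lemma binomialRandom_biInter_edgeEvent {F : Finset (Sym2 V)} (hF : ∀ e ∈ F, ¬ e.IsDiag) :
    G(V, p) (⋂ e ∈ F, edgeEvent e) = (unitInterval.toNNReal p : ENNReal) ^ F.card := by
  classical
  have hpreimage : (fun q : Sym2 V → Prop => {e | q e}) ⁻¹'
      (SimpleGraph.fromEdgeSet ⁻¹' (⋂ e ∈ F, edgeEvent e)) =
        Set.pi (F : Set (Sym2 V)) fun _ => {True} := by
    ext f
    simp only [edgeEvent, Set.preimage_iInter, Set.mem_iInter, Set.mem_preimage,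
      Set.mem_ofPred_eq, Set.mem_pi, Finset.mem_coe, Set.mem_singleton_iff,
      SimpleGraph.edgeSet_fromEdgeSet, Set.mem_sdiff]
    exact forall₂_congr fun e he => by simp [hF e he]
  rw [SimpleGraph.binomialRandom_eq_map, Measure.map_apply SimpleGraph.measurable_fromEdgeSet
      (F.measurableSet_biInter fun e _ => measurableSet_edgeEvent e),
    setBernoulli_apply', hpreimage, Measure.infinitePi_pi _ fun _ _ => .of_discrete,
    ← Finset.prod_const]
  exact Finset.prod_congr rfl fun e he => by simp [hF e he]

lemma iIndepSet_edgeEvent : iIndepSet (edgeEvent : Sym2 V → Set (SimpleGraph V)) G(V, p) := by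
  rw [iIndepSet_iff_meas_biInter measurableSet_edgeEvent]
  intro F
  by_cases hF : ∀ e ∈ F, ¬ e.IsDiag
  · rw [binomialRandom_biInter_edgeEvent p hF, ← Finset.prod_const]
    refine Finset.prod_congr rfl fun e he => ?_
    simpa using (binomialRandom_biInter_edgeEvent p (F := {e}) (by simpa using hF e he)).symm
  · push Not at hF
    obtain ⟨e, he, hdiag⟩ := hF
    have hempty : (edgeEvent e : Set (SimpleGraph V)) = ∅ :=
      Set.eq_empty_of_forall_notMem fun G h => G.not_isDiag_of_mem_edgeSet h hdiag
    rw [Finset.prod_eq_zero he (by simp [hempty])]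
    exact measure_mono_null (Set.biInter_subset_of_mem he) (by simp [hempty])

lemma real_inter_of_disjoint {S T : Set (Sym2 V)} (hST : Disjoint S T)
    {A B : Set (SimpleGraph V)} (hA : MeasurableSet[edgeSpace S] A)
    (hB : MeasurableSet[edgeSpace T] B) :
    G(V, p).real (A ∩ B) = G(V, p).real A * G(V, p).real B := by
  have hindep : Indep (edgeSpace S) (edgeSpace T) G(V, p) :=
    indep_iSup_of_disjoint
      (fun e => MeasurableSpace.generateFrom_le <| by rintro _ rfl; exact measurableSet_edgeEvent e)
      ((iIndepSet_iff_iIndep _ _).1 (iIndepSet_edgeEvent p)) hST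
  rw [Measure.real, (Indep_iff _ _ _).1 hindep A B hA hB, ENNReal.toReal_mul]
  rfl

lemma real_biInter_of_pairwiseDisjoint {ι : Type*} {s : Finset ι} {T : ι → Set (Sym2 V)}
    {B : ι → Set (SimpleGraph V)} (hB : ∀ i ∈ s, MeasurableSet[edgeSpace (T i)] (B i))
    (hT : (s : Set ι).PairwiseDisjoint T) :
    G(V, p).real (⋂ i ∈ s, B i) = ∏ i ∈ s, G(V, p).real (B i) := by
  classical
  induction s using Finset.induction_on with
  | empty => simp
  | insert i s hi ih =>
    rw [Finset.coe_insert, Set.pairwiseDisjoint_insert_of_notMem (by simpa using hi)] at hT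
    rw [Finset.forall_mem_insert] at hB
    have hrest : MeasurableSet[edgeSpace (⋃ j ∈ s, T j)] (⋂ j ∈ s, B j) :=
      s.measurableSet_biInter fun j hj =>
        edgeSpace_mono (Set.subset_biUnion_of_mem (u := T) (Finset.mem_coe.2 hj)) _ (hB.2 j hj)
    rw [Finset.set_biInter_insert, Finset.prod_insert hi,
      real_inter_of_disjoint p (Set.disjoint_iUnion₂_right.2 hT.2) hB.1 hrest, ih hB.2 hT.1]

instance : MeasurableSingletonClass (SimpleGraph V) where
  measurableSet_singleton G := by
    have hpreimage : ({G} : Set (SimpleGraph V)) = SimpleGraph.edgeSet ⁻¹' {G.edgeSet} := by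
      ext H
      simp
    rw [hpreimage]
    exact SimpleGraph.measurable_edgeSet (measurableSet_singleton _)

lemma map_compl_binomialRandom [Finite V] : G(V, p).map compl = G(V, σ p) := by
  classical
  cases nonempty_fintype V
  refine Measure.ext_of_singleton fun G => ?_
  have hpreimage : compl ⁻¹' {G} = {Gᶜ} := by
    ext H
    exact compl_eq_comm.trans eq_comm
  have hcard : G.edgeSet.ncard + Gᶜ.edgeSet.ncard = (Nat.card V).choose 2 := by
    rw [← Set.ncard_union_eq (SimpleGraph.disjoint_edgeSet.2 disjoint_compl_right),
      ← SimpleGraph.edgeSet_sup, sup_compl_eq_top, Nat.card_eq_fintype_card,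
      ← SimpleGraph.card_edgeFinset_top_eq_card_choose_two, ← Set.ncard_coe_finset,
      SimpleGraph.coe_edgeFinset]
  rw [Measure.map_apply .of_discrete (measurableSet_singleton G), hpreimage,
    SimpleGraph.binomialRandom_singleton, SimpleGraph.binomialRandom_singleton, ← hcard,
    Nat.add_sub_cancel_left, Nat.add_sub_cancel, unitInterval.symm_symm, mul_comm]

/-- The probability `p` or `1 - p` that a given pair is an edge (`b = true`) or a non-edge
(`b = false`) of `G(V, p)`. -/
noncomputable def edgeProb (p : I) (b : Bool) : ℝ := bif b then (p : ℝ) else 1 - p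

lemma edgeProb_mem_Icc (b : Bool) : edgeProb p b ∈ Set.Icc (0 : ℝ) 1 := by
  cases b
  · exact (σ p).2
  · exact p.2

lemma edgeProb_pos {p : I} (hp0 : 0 < (p : ℝ)) (hp1 : (p : ℝ) < 1) (b : Bool) :
    0 < edgeProb p b := by
  cases b
  · exact sub_pos.2 hp1
  · exact hp0

lemma real_statusEvent (b : Bool) {F : Finset (Sym2 V)} (hF : ∀ e ∈ F, ¬ e.IsDiag) :
    G(V, p).real (statusEvent b F) = edgeProb p b ^ F.card := by
  have hedge : ∀ e ∈ F, G(V, p).real (edgeEvent e) = p := fun e he => by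
    simpa [Measure.real] using congrArg ENNReal.toReal
      (binomialRandom_biInter_edgeEvent p (F := {e}) (by simpa using hF e he))
  rw [statusEvent_eq_biInter, real_biInter_of_pairwiseDisjoint p (T := fun e => {e}),
    ← Finset.prod_const]
  · refine Finset.prod_congr rfl fun e he => ?_
    cases b
    · simp only [cond_false, edgeProb, probReal_compl_eq_one_sub (measurableSet_edgeEvent e),
        hedge e he]
    · simp only [cond_true, edgeProb, hedge e he]
  · intro e _
    cases b
    · exact (measurableSet_edgeSpace_edgeEvent (Set.mem_singleton e)).compl
    · exact measurableSet_edgeSpace_edgeEvent (Set.mem_singleton e)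
  · exact fun e _ f _ hef => Set.disjoint_singleton.2 hef

end RandomGraph

section Events

variable {V : Type*}

/-- The event that `X` is a clique. -/
def cliqueEvent (X : Finset V) : Set (SimpleGraph V) := {G | G.IsClique (X : Set V)}

/-- The event that `z` is adjacent to all (`b = true`) or to none (`b = false`) of the vertices
in `X`. -/
def uniformEvent (b : Bool) (z : V) (X : Finset V) : Set (SimpleGraph V) :=
  {G | ∀ x ∈ X, (G.Adj z x ↔ b = true)}

/-- The event that `X` is a clique with which `v` is uniformly joined in the sense of
`uniformEvent`. -/
def rootedEvent (b : Bool) (v : V) (X : Finset V) : Set (SimpleGraph V) :=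
  cliqueEvent X ∩ uniformEvent b v X

/-- The event that no vertex outside `Y` is uniformly joined to `X` in the sense of
`uniformEvent`. -/
def noUniformEvent (b : Bool) (X Y : Finset V) : Set (SimpleGraph V) :=
  ⋂ z ∉ Y, (uniformEvent b z X)ᶜ

variable [DecidableEq V]

/-- The set of pairs of distinct elements of `X`. -/
def pairs (X : Finset V) : Finset (Sym2 V) := X.offDiag.image Sym2.mk.uncurry

/-- The set of pairs consisting of `z` and an element of `X`. -/
def starPairs (z : V) (X : Finset V) : Finset (Sym2 V) := X.image fun x => s(z, x)

lemma mk_mem_pairs {X : Finset V} {a b : V} : s(a, b) ∈ pairs X ↔ a ∈ X ∧ b ∈ X ∧ a ≠ b := by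
  simp only [pairs, Finset.mem_image, Finset.mem_offDiag, Prod.exists, Function.uncurry_apply_pair,
    Sym2.eq_iff]
  grind

lemma not_isDiag_of_mem_pairs {X : Finset V} {e : Sym2 V} (he : e ∈ pairs X) : ¬ e.IsDiag := by
  induction e with | _ a b
  exact (mk_mem_pairs.1 he).2.2

lemma not_isDiag_of_mem_starPairs {z : V} {X : Finset V} (hz : z ∉ X) {e : Sym2 V}
    (he : e ∈ starPairs z X) : ¬ e.IsDiag := by
  obtain ⟨x, hx, rfl⟩ := Finset.mem_image.1 he
  exact fun h => hz (Sym2.mk_isDiag_iff.1 h ▸ hx)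

lemma card_pairs (X : Finset V) : (pairs X).card = X.card.choose 2 := Sym2.card_image_offDiag X

lemma card_starPairs (z : V) (X : Finset V) : (starPairs z X).card = X.card :=
  Finset.card_image_of_injective _ fun _ _ h => Sym2.congr_right.1 h

lemma pairs_mono {X Y : Finset V} (h : X ⊆ Y) : pairs X ⊆ pairs Y :=
  Finset.image_subset_image (Finset.offDiag_mono h)

lemma starPairs_mono (z : V) {X Y : Finset V} (h : X ⊆ Y) : starPairs z X ⊆ starPairs z Y :=
  Finset.image_subset_image h

lemma pairs_inter (X Y : Finset V) : pairs X ∩ pairs Y = pairs (X ∩ Y) := by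
  ext e
  induction e with | _ a b
  simp only [Finset.mem_inter, mk_mem_pairs]
  tauto

lemma starPairs_subset_pairs_insert {v : V} {X : Finset V} (hv : v ∉ X) :
    starPairs v X ⊆ pairs (insert v X) := by
  intro e he
  obtain ⟨x, hx, rfl⟩ := Finset.mem_image.1 he
  exact mk_mem_pairs.2
    ⟨Finset.mem_insert_self v X, Finset.mem_insert_of_mem hx, fun h => hv (h ▸ hx)⟩

lemma card_pairs_union (X Y : Finset V) :
    (pairs X ∪ pairs Y).card + (X ∩ Y).card.choose 2 = X.card.choose 2 + Y.card.choose 2 := by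
  rw [← card_pairs, ← card_pairs, ← card_pairs, ← pairs_inter, Finset.card_union_add_card_inter]

lemma disjoint_pairs_starPairs {X Y : Finset V} {z : V} (hz : z ∉ X) :
    Disjoint (pairs X) (starPairs z Y) := by
  rw [Finset.disjoint_right]
  intro e he
  obtain ⟨y, -, rfl⟩ := Finset.mem_image.1 he
  exact fun h => hz (mk_mem_pairs.1 h).1

lemma disjoint_starPairs {X Y : Finset V} {z w : V} (hzw : z ≠ w) (hz : z ∉ Y) :
    Disjoint (starPairs z X) (starPairs w Y) := by
  simp only [Finset.disjoint_left, starPairs, Finset.mem_image, not_exists, not_and]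
  rintro _ ⟨x, -, rfl⟩ y hy h
  rcases Sym2.eq_iff.1 h with ⟨h, -⟩ | ⟨-, h⟩
  · exact hzw h.symm
  · exact hz (h ▸ hy)

lemma cliqueEvent_eq_statusEvent (X : Finset V) : cliqueEvent X = statusEvent true (pairs X) := by
  ext G
  simp only [cliqueEvent, statusEvent, Set.mem_ofPred_eq, Sym2.forall, mk_mem_pairs,
    SimpleGraph.mem_edgeSet, iff_true, SimpleGraph.isClique_iff, Set.Pairwise, Finset.mem_coe]
  grind

lemma uniformEvent_eq_statusEvent (b : Bool) (z : V) (X : Finset V) :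
    uniformEvent b z X = statusEvent b (starPairs z X) := by
  ext G
  simp [uniformEvent, statusEvent, starPairs]

lemma rootedEvent_true {v : V} {X : Finset V} (hv : v ∉ X) :
    rootedEvent true v X = cliqueEvent (insert v X) := by
  ext G
  simp only [rootedEvent, cliqueEvent, uniformEvent, Set.mem_inter_iff, Set.mem_ofPred_eq,
    Finset.coe_insert, SimpleGraph.isClique_insert_of_notMem (Finset.mem_coe.not.2 hv),
    Finset.mem_coe, iff_true]

lemma uniformEvent_union (b : Bool) (z : V) (X Y : Finset V) :
    uniformEvent b z (X ∪ Y) = uniformEvent b z X ∩ uniformEvent b z Y := by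
  ext G
  simp only [uniformEvent, Set.mem_ofPred_eq, Set.mem_inter_iff, Finset.forall_mem_union]

lemma measurableSet_cliqueEvent (X : Finset V) :
    MeasurableSet[edgeSpace (pairs X : Set (Sym2 V))] (cliqueEvent X) := by
  rw [cliqueEvent_eq_statusEvent]
  exact measurableSet_statusEvent true _

lemma measurableSet_uniformEvent (b : Bool) (z : V) (X : Finset V) :
    MeasurableSet[edgeSpace (starPairs z X : Set (Sym2 V))] (uniformEvent b z X) := by
  rw [uniformEvent_eq_statusEvent]
  exact measurableSet_statusEvent b _

lemma measurableSet_cliqueEvent_inter (X Y : Finset V) :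
    MeasurableSet[edgeSpace (pairs (X ∪ Y) : Set (Sym2 V))] (cliqueEvent X ∩ cliqueEvent Y) :=
  (edgeSpace_mono (mod_cast pairs_mono Finset.subset_union_left) _
    (measurableSet_cliqueEvent X)).inter
  (edgeSpace_mono (mod_cast pairs_mono Finset.subset_union_right) _
    (measurableSet_cliqueEvent Y))

lemma measurableSet_rootedEvent (b : Bool) {v : V} {X : Finset V} (hv : v ∉ X) :
    MeasurableSet[edgeSpace (pairs (insert v X) : Set (Sym2 V))] (rootedEvent b v X) :=
  (edgeSpace_mono (mod_cast pairs_mono (Finset.subset_insert v X)) _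
    (measurableSet_cliqueEvent X)).inter
  (edgeSpace_mono (mod_cast starPairs_subset_pairs_insert hv) _
    (measurableSet_uniformEvent b v X))

section Countable

variable [Countable V] (p : I)

omit [DecidableEq V] in
lemma real_cliqueEvent (X : Finset V) :
    G(V, p).real (cliqueEvent X) = (p : ℝ) ^ X.card.choose 2 := by
  classical
  rw [cliqueEvent_eq_statusEvent, real_statusEvent p true fun _ => not_isDiag_of_mem_pairs,
    card_pairs]
  rfl

lemma real_cliqueEvent_inter (X Y : Finset V) :
    G(V, p).real (cliqueEvent X ∩ cliqueEvent Y) * (p : ℝ) ^ (X ∩ Y).card.choose 2 =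
      (p : ℝ) ^ X.card.choose 2 * (p : ℝ) ^ Y.card.choose 2 := by
  have hinter : cliqueEvent X ∩ cliqueEvent Y = statusEvent true (pairs X ∪ pairs Y) := by
    ext G
    simp only [cliqueEvent_eq_statusEvent, statusEvent, Set.mem_inter_iff, Set.mem_ofPred_eq,
      Finset.forall_mem_union]
  rw [hinter, real_statusEvent, edgeProb, cond_true, ← pow_add, card_pairs_union, pow_add]
  simp only [Finset.forall_mem_union]
  exact ⟨fun _ => not_isDiag_of_mem_pairs, fun _ => not_isDiag_of_mem_pairs⟩

omit [DecidableEq V] in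
lemma real_uniformEvent (b : Bool) {z : V} {X : Finset V} (hz : z ∉ X) :
    G(V, p).real (uniformEvent b z X) = edgeProb p b ^ X.card := by
  classical
  rw [uniformEvent_eq_statusEvent,
    real_statusEvent p b fun _ => not_isDiag_of_mem_starPairs hz, card_starPairs]

omit [DecidableEq V] in
lemma real_rootedEvent (b : Bool) {v : V} {X : Finset V} (hv : v ∉ X) :
    G(V, p).real (rootedEvent b v X) = (p : ℝ) ^ X.card.choose 2 * edgeProb p b ^ X.card := by
  classical
  rw [rootedEvent, real_inter_of_disjoint p (mod_cast disjoint_pairs_starPairs hv)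
    (measurableSet_cliqueEvent X) (measurableSet_uniformEvent b v X), real_cliqueEvent,
    real_uniformEvent p b hv]

lemma real_rootedEvent_inter (b : Bool) {v : V} {X Y : Finset V} (hX : v ∉ X) (hY : v ∉ Y) :
    G(V, p).real (rootedEvent b v X ∩ rootedEvent b v Y) *
      ((p : ℝ) ^ (X ∩ Y).card.choose 2 * edgeProb p b ^ (X ∩ Y).card) =
      ((p : ℝ) ^ X.card.choose 2 * edgeProb p b ^ X.card) *
        ((p : ℝ) ^ Y.card.choose 2 * edgeProb p b ^ Y.card) := by
  have hv : v ∉ X ∪ Y := Finset.notMem_union.2 ⟨hX, hY⟩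
  have hcard : edgeProb p b ^ (X ∪ Y).card * edgeProb p b ^ (X ∩ Y).card =
      edgeProb p b ^ X.card * edgeProb p b ^ Y.card := by
    rw [← pow_add, ← pow_add, Finset.card_union_add_card_inter]
  rw [rootedEvent, rootedEvent, Set.inter_inter_inter_comm, ← uniformEvent_union,
    real_inter_of_disjoint p (mod_cast disjoint_pairs_starPairs hv)
      (measurableSet_cliqueEvent_inter X Y) (measurableSet_uniformEvent b v (X ∪ Y)),
    real_uniformEvent p b hv, mul_mul_mul_comm, real_cliqueEvent_inter, hcard,
    mul_mul_mul_comm]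

end Countable

lemma real_compl_uniformEvent_inter [Finite V] (p : I) (b : Bool) {z : V} {X Y : Finset V}
    (hz : z ∉ X ∪ Y) :
    G(V, p).real ((uniformEvent b z X)ᶜ ∩ (uniformEvent b z Y)ᶜ) =
      1 - edgeProb p b ^ X.card - edgeProb p b ^ Y.card + edgeProb p b ^ (X ∪ Y).card := by
  obtain ⟨hX, hY⟩ := Finset.notMem_union.1 hz
  have hunion := measureReal_union_add_inter (μ := G(V, p)) (s := uniformEvent b z X)
    (t := uniformEvent b z Y) .of_discrete
  rw [← uniformEvent_union, real_uniformEvent p b hz, real_uniformEvent p b hX,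
    real_uniformEvent p b hY] at hunion
  rw [← Set.compl_union, probReal_compl_eq_one_sub .of_discrete]
  linarith

variable [Fintype V] (p : I)

lemma real_inter_biInter_compl {X Y : Finset V} (hXY : X ⊆ Y) {A : Set (SimpleGraph V)}
    (hA : MeasurableSet[edgeSpace (pairs Y : Set (Sym2 V))] A) {B : V → Set (SimpleGraph V)}
    (hB : ∀ z, MeasurableSet[edgeSpace (starPairs z X : Set (Sym2 V))] (B z)) :
    G(V, p).real (A ∩ ⋂ z ∈ Yᶜ, B z) = G(V, p).real A * ∏ z ∈ Yᶜ, G(V, p).real (B z) := by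
  have hinter : MeasurableSet[edgeSpace (⋃ z ∈ Yᶜ, (starPairs z X : Set (Sym2 V)))]
      (⋂ z ∈ Yᶜ, B z) :=
    Finset.measurableSet_biInter _ fun z hz =>
      edgeSpace_mono (Set.subset_biUnion_of_mem (u := fun z => (starPairs z X : Set (Sym2 V))) hz)
        _ (hB z)
  have hstar : Disjoint (pairs Y : Set (Sym2 V)) (⋃ z ∈ Yᶜ, (starPairs z X : Set (Sym2 V))) :=
    Set.disjoint_iUnion₂_right.2 fun z hz =>
      mod_cast disjoint_pairs_starPairs (Finset.mem_compl.1 hz)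
  rw [real_inter_of_disjoint p hstar hA hinter,
    real_biInter_of_pairwiseDisjoint p (fun z _ => hB z)]
  intro z hz w _ hzw
  rw [Function.onFun, Finset.disjoint_coe]
  exact disjoint_starPairs hzw fun h => Finset.mem_compl.1 hz (hXY h)

lemma real_inter_noUniformEvent (b : Bool) {X Y : Finset V} (hXY : X ⊆ Y)
    {A : Set (SimpleGraph V)} (hA : MeasurableSet[edgeSpace (pairs Y : Set (Sym2 V))] A) :
    G(V, p).real (A ∩ noUniformEvent b X Y) =
      G(V, p).real A * (1 - edgeProb p b ^ X.card) ^ (Fintype.card V - Y.card) := by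
  have hcompl : ∀ z ∈ Yᶜ, G(V, p).real (uniformEvent b z X)ᶜ = 1 - edgeProb p b ^ X.card := by
    intro z hz
    rw [probReal_compl_eq_one_sub .of_discrete,
      real_uniformEvent p b fun h => Finset.mem_compl.1 hz (hXY h)]
  have hinter : noUniformEvent b X Y = ⋂ z ∈ Yᶜ, (uniformEvent b z X)ᶜ := by
    simp only [noUniformEvent, Finset.mem_compl]
  rw [hinter, real_inter_biInter_compl p hXY hA fun z => (measurableSet_uniformEvent b z X).compl,
    Finset.prod_congr rfl hcompl, Finset.prod_const, Finset.card_compl]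

lemma real_inter_noUniformEvent_inter_le (b : Bool) {X Y X' Y' : Finset V} (hXY : X ⊆ Y)
    (hXY' : X' ⊆ Y') {A : Set (SimpleGraph V)}
    (hA : MeasurableSet[edgeSpace (pairs (Y ∪ Y') : Set (Sym2 V))] A) :
    G(V, p).real (A ∩ (noUniformEvent b X Y ∩ noUniformEvent b X' Y')) ≤
      G(V, p).real A *
        (1 - edgeProb p b ^ X.card - edgeProb p b ^ X'.card + edgeProb p b ^ (X ∪ X').card) ^
          (Fintype.card V - (Y ∪ Y').card) := by
  have hsub : noUniformEvent b X Y ∩ noUniformEvent b X' Y' ⊆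
      ⋂ z ∈ (Y ∪ Y')ᶜ, ((uniformEvent b z X)ᶜ ∩ (uniformEvent b z X')ᶜ) := by
    refine Set.subset_iInter₂ fun z hz => Set.inter_subset_inter ?_ ?_
    · exact Set.biInter_subset_of_mem fun h => Finset.mem_compl.1 hz (Finset.mem_union_left _ h)
    · exact Set.biInter_subset_of_mem fun h => Finset.mem_compl.1 hz (Finset.mem_union_right _ h)
  have hunion : X ∪ X' ⊆ Y ∪ Y' := Finset.union_subset_union hXY hXY'
  have hmeas : ∀ z, MeasurableSet[edgeSpace (starPairs z (X ∪ X') : Set (Sym2 V))]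
      ((uniformEvent b z X)ᶜ ∩ (uniformEvent b z X')ᶜ) := fun z => by
    rw [← Set.compl_union]
    exact ((edgeSpace_mono (mod_cast starPairs_mono z Finset.subset_union_left) _
      (measurableSet_uniformEvent b z X)).union
      (edgeSpace_mono (mod_cast starPairs_mono z Finset.subset_union_right) _
      (measurableSet_uniformEvent b z X'))).compl
  refine (measureReal_mono (Set.inter_subset_inter_right A hsub)).trans_eq ?_
  rw [real_inter_biInter_compl p hunion hA hmeas,
    Finset.prod_congr rfl fun z hz =>
      real_compl_uniformEvent_inter p b fun h => Finset.mem_compl.1 hz (hunion h),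
    Finset.prod_const, Finset.card_compl]

end Events

section Witnesses

variable {V : Type*} {G : SimpleGraph V}

lemma PhiC1.phiC3 (h : PhiC1 G) : PhiC3 G := fun X hX => absurd (h X hX.1) hX.2

lemma exists_set_iff_exists_finset [Finite V] {P : Set V → Prop} :
    (∃ X, P X) ↔ ∃ X : Finset V, P X :=
  ⟨fun ⟨X, hX⟩ => ⟨X.toFinite.toFinset, by simpa using hX⟩, fun ⟨X, hX⟩ => ⟨X, hX⟩⟩

lemma not_phiC1_iff [Finite V] :
    ¬ PhiC1 G ↔ ∃ X : Finset V, G ∈ cliqueEvent X ∩ noUniformEvent false X X := by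
  simp only [PhiC1, PhiC, not_forall, exists_prop, exists_set_iff_exists_finset]
  refine exists_congr fun X => ?_
  simp [cliqueEvent, noUniformEvent, uniformEvent]

variable [DecidableEq V]

/-- The event that the clique `X` and the vertex `v` witness the failure of `φ³_C` (`b = true`) or
of `φ²_C` (`b = false`): `v` is adjacent to all, respectively to none, of the vertices in `X`, and
no vertex outside `insert v X` does the opposite. -/
def witnessEvent (b : Bool) (v : V) (X : Finset V) : Set (SimpleGraph V) :=
  rootedEvent b v X ∩ noUniformEvent (!b) X (insert v X)

lemma mem_witnessEvent {b : Bool} {v : V} {X : Finset V} :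
    G ∈ witnessEvent b v X ↔ G.IsClique (X : Set V) ∧ (∀ x ∈ X, (G.Adj v x ↔ b = true)) ∧
      ∀ z, z ≠ v → z ∉ X → ∃ x ∈ X, (G.Adj z x ↔ b = true) := by
  cases b <;>
    simp [witnessEvent, rootedEvent, noUniformEvent, cliqueEvent, uniformEvent, and_assoc]

variable [Finite V]

lemma not_phiC2_iff : ¬ PhiC2 G ↔
    ∃ (v : V) (X : Finset V), X.Nonempty ∧ v ∉ X ∧ G ∈ witnessEvent false v X := by
  simp only [PhiC2, PhiC, MaxCl, not_forall, exists_prop, exists_set_iff_exists_finset,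
    mem_witnessEvent, Finset.mem_coe, not_not]
  constructor
  · rintro ⟨X, ⟨hX, hmax⟩, v, hv, hvX⟩
    push Not at hmax
    obtain ⟨x, hx, -⟩ := hmax v hv
    exact ⟨v, X, ⟨x, hx⟩, hv, hX, by simpa using hvX, fun z _ hz => by simpa using hmax z hz⟩
  · rintro ⟨v, X, ⟨x, hx⟩, hv, hX, hvX, hmax⟩
    refine ⟨X, ⟨hX, ?_⟩, v, hv, by simpa using hvX⟩
    rintro ⟨z, hz, hzX⟩
    by_cases hzv : z = v
    · exact absurd (hzv ▸ hzX x hx) (by simpa using hvX x hx)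
    · obtain ⟨y, hy, hzy⟩ := hmax z hzv hz
      exact absurd (hzX y hy) (by simpa using hzy)

lemma not_phiC3_iff : ¬ PhiC3 G ↔
    ∃ (v : V) (X : Finset V), X.Nonempty ∧ v ∉ X ∧ G ∈ witnessEvent true v X := by
  simp only [PhiC3, PhiC, MaxCl, not_forall, exists_prop, exists_set_iff_exists_finset,
    mem_witnessEvent, Finset.mem_coe, iff_true]
  constructor
  · rintro ⟨X, ⟨hX, hdom⟩, hmax⟩
    obtain ⟨v, hv, hvX⟩ := not_not.1 fun h => hmax ⟨hX, h⟩
    push Not at hdom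
    obtain ⟨x, hx, -⟩ := hdom v hv
    exact ⟨v, X, ⟨x, hx⟩, hv, hX, hvX, fun z _ hz => hdom z hz⟩
  · rintro ⟨v, X, ⟨x, hx⟩, hv, hX, hvX, hdom⟩
    refine ⟨X, ⟨hX, ?_⟩, fun h => h.2 ⟨v, hv, hvX⟩⟩
    rintro ⟨z, hz, hzX⟩
    by_cases hzv : z = v
    · exact hzX x hx (hzv ▸ hvX x hx)
    · obtain ⟨y, hy, hzy⟩ := hdom z hzv hz
      exact hzX y hy hzy

end Witnesses

section FirstMoment

variable {V : Type*} [Fintype V] (p : I)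

lemma real_witnessEvent [DecidableEq V] (b : Bool) {v : V} {X : Finset V} (hv : v ∉ X) :
    G(V, p).real (witnessEvent b v X) = (p : ℝ) ^ X.card.choose 2 * edgeProb p b ^ X.card *
      (1 - edgeProb p (!b) ^ X.card) ^ (Fintype.card V - (X.card + 1)) := by
  rw [witnessEvent, real_inter_noUniformEvent p (!b) (Finset.subset_insert v X)
    (measurableSet_rootedEvent b hv), real_rootedEvent p b hv, Finset.card_insert_of_notMem hv]

lemma real_not_phiC1_le :
    G(V, p).real {G | ¬ PhiC1 G} ≤ ∑ k ∈ Finset.range (Fintype.card V + 1),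
      (Fintype.card V).choose k *
        ((p : ℝ) ^ k.choose 2 * (1 - (1 - p : ℝ) ^ k) ^ (Fintype.card V - k)) := by
  classical
  have hsub : {G : SimpleGraph V | ¬ PhiC1 G} ⊆
      ⋃ X ∈ (Finset.univ : Finset V).powerset, cliqueEvent X ∩ noUniformEvent false X X := by
    intro G hG
    obtain ⟨X, hX⟩ := not_phiC1_iff.1 hG
    exact Set.mem_biUnion (Finset.mem_powerset.2 X.subset_univ) hX
  have hX : ∀ X : Finset V, G(V, p).real (cliqueEvent X ∩ noUniformEvent false X X) =
      (p : ℝ) ^ X.card.choose 2 * (1 - (1 - p : ℝ) ^ X.card) ^ (Fintype.card V - X.card) := by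
    intro X
    rw [real_inter_noUniformEvent p false subset_rfl (measurableSet_cliqueEvent X),
      real_cliqueEvent, edgeProb, cond_false]
  refine (measureReal_mono hsub (measure_ne_top _ _)).trans
    ((measureReal_biUnion_finset_le _ _).trans_eq ?_)
  simp_rw [hX, ← nsmul_eq_mul]
  exact Finset.sum_powerset_apply_card fun k =>
    (p : ℝ) ^ k.choose 2 * (1 - (1 - p : ℝ) ^ k) ^ (Fintype.card V - k)

lemma real_not_phiC3_le :
    G(V, p).real {G | ¬ PhiC3 G} ≤ ∑ k ∈ Finset.range (Fintype.card V + 1),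
      (Fintype.card V).choose k * ((Fintype.card V - k : ℕ) *
        ((p : ℝ) ^ (k + 1).choose 2 * (1 - (1 - p : ℝ) ^ k) ^ (Fintype.card V - (k + 1)))) := by
  classical
  have hsub : {G : SimpleGraph V | ¬ PhiC3 G} ⊆
      ⋃ X ∈ (Finset.univ : Finset V).powerset, ⋃ v ∈ Xᶜ, witnessEvent true v X := by
    intro G hG
    obtain ⟨v, X, -, hv, hX⟩ := not_phiC3_iff.1 hG
    exact Set.mem_biUnion (Finset.mem_powerset.2 X.subset_univ)
      (Set.mem_biUnion (Finset.mem_compl.2 hv) hX)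
  have hX : ∀ X : Finset V, G(V, p).real (⋃ v ∈ Xᶜ, witnessEvent true v X) ≤
      (Fintype.card V - X.card : ℕ) * ((p : ℝ) ^ (X.card + 1).choose 2 *
        (1 - (1 - p : ℝ) ^ X.card) ^ (Fintype.card V - (X.card + 1))) := by
    intro X
    refine (measureReal_biUnion_finset_le _ _).trans_eq ?_
    rw [Finset.sum_congr rfl fun v hv => real_witnessEvent p true (Finset.mem_compl.1 hv),
      Finset.sum_const, Finset.card_compl, nsmul_eq_mul, edgeProb, edgeProb, cond_true,
      Bool.not_true, cond_false, ← pow_add, Nat.choose_succ_succ' _ 1, Nat.choose_one_right,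
      add_comm (X.card.choose 2)]
  refine (measureReal_mono hsub (measure_ne_top _ _)).trans
    ((measureReal_biUnion_finset_le _ _).trans ((Finset.sum_le_sum fun X _ => hX X).trans_eq ?_))
  simp_rw [← nsmul_eq_mul ((Fintype.card V).choose _)]
  exact Finset.sum_powerset_apply_card fun k => ((Fintype.card V - k : ℕ) : ℝ) *
    ((p : ℝ) ^ (k + 1).choose 2 * (1 - (1 - p : ℝ) ^ k) ^ (Fintype.card V - (k + 1)))

end FirstMoment

section Prob

variable {n : ℕ} {p : I} {Q : SimpleGraph (Fin n) → Prop}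

lemma prob_not : prob n p (fun G => ¬ Q G) = 1 - prob n p Q := by
  rw [prob, prob, ← probReal_compl_eq_one_sub .of_discrete]
  rfl

lemma prob_nonneg : 0 ≤ prob n p Q := measureReal_nonneg

lemma tendsto_prob_one {N : ℕ → ℕ} {Q : ∀ n, SimpleGraph (Fin n) → Prop} {f : ℕ → ℝ}
    (hf : Tendsto f atTop (𝓝 0)) (h : ∀ m, prob (N m) p (fun G => ¬ Q (N m) G) ≤ f m) :
    Tendsto (fun m => prob (N m) p (Q (N m))) atTop (𝓝 1) := by
  have hnot := (squeeze_zero (fun m => prob_nonneg) h hf).const_sub 1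
  simpa only [prob_not, sub_sub_cancel, sub_zero] using hnot

end Prob

section Estimates

lemma tendsto_sum_range_of_dominated {f : ℕ → ℕ → ℝ} {bound : ℕ → ℝ} (hb : Summable bound)
    (hb0 : ∀ k, 0 ≤ bound k) {N : ℕ → ℕ} (hf : ∀ᶠ m in atTop, ∀ k ≤ N m, |f m k| ≤ bound k)
    (hlim : ∀ k, Tendsto (fun m => f m k) atTop (𝓝 0)) :
    Tendsto (fun m => ∑ k ∈ Finset.range (N m + 1), f m k) atTop (𝓝 0) := by
  set F : ℕ → ℕ → ℝ := fun m k => if k ≤ N m then f m k else 0 with hF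
  have hFsum : ∀ m, ∑' k, F m k = ∑ k ∈ Finset.range (N m + 1), f m k := by
    intro m
    rw [tsum_eq_sum (s := Finset.range (N m + 1)) fun k hk =>
      if_neg fun h => hk (Finset.mem_range_succ_iff.2 h)]
    exact Finset.sum_congr rfl fun k hk => if_pos (Finset.mem_range_succ_iff.1 hk)
  have hFlim : ∀ k, Tendsto (fun m => F m k) atTop (𝓝 0) := fun k =>
    squeeze_zero_norm (fun m => by by_cases h : k ≤ N m <;> simp [hF, h])
      (tendsto_zero_iff_abs_tendsto_zero _ |>.1 (hlim k))
  have hFb : ∀ᶠ m in atTop, ∀ k, ‖F m k‖ ≤ bound k := by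
    filter_upwards [hf] with m hm k
    by_cases h : k ≤ N m
    · simpa [hF, h] using hm k h
    · simpa [hF, h] using hb0 k
  simpa only [hFsum, tsum_zero] using tendsto_tsum_of_dominated_convergence hb hFlim hFb

lemma nat_mul_pow_le {q : ℝ} (h0 : 0 ≤ q) (h1 : q < 1) (k : ℕ) : k * q ^ k ≤ 1 / (1 - q) := by
  have hle : ∑ _i ∈ Finset.range k, q ^ k ≤ ∑ i ∈ Finset.range k, q ^ i :=
    Finset.sum_le_sum fun _ hi => pow_le_pow_of_le_one h0 h1.le (Finset.mem_range.1 hi).le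
  have hsum : ∑ i ∈ Finset.range k, q ^ i ≤ ∑' i, q ^ i :=
    (summable_geometric_of_lt_one h0 h1).sum_le_tsum _ fun i _ => pow_nonneg h0 i
  rw [Finset.sum_const, Finset.card_range, nsmul_eq_mul] at hle
  rw [tsum_geometric_of_lt_one h0 h1] at hsum
  simpa only [one_div] using hle.trans hsum

lemma one_sub_pow_pow_le {q : ℝ} (h0 : 0 ≤ q) (h1 : q < 1) {n k j : ℕ} (hj : j ≤ n)
    (hk : j ≤ k + 1) :
    (1 - q ^ k) ^ (n - j) ≤ Real.exp (1 + 1 / (1 - q)) * Real.exp (-(n * q ^ k)) := by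
  have hq : q ^ k ≤ 1 := pow_le_one₀ h0 h1.le
  have hjk : (j : ℝ) * q ^ k ≤ 1 + 1 / (1 - q) := by
    have hj' : (j : ℝ) * q ^ k ≤ (k + 1) * q ^ k := by
      gcongr
      exact_mod_cast hk
    linarith [nat_mul_pow_le h0 h1 k]
  calc (1 - q ^ k) ^ (n - j) ≤ Real.exp (-q ^ k) ^ (n - j) :=
        pow_le_pow_left₀ (by linarith) (Real.one_sub_le_exp_neg _) _
    _ = Real.exp (j * q ^ k - n * q ^ k) := by
        rw [← Real.exp_nat_mul, Nat.cast_sub hj]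
        ring_nf
    _ ≤ Real.exp (1 + 1 / (1 - q) - n * q ^ k) := by gcongr
    _ = _ := by rw [← Real.exp_add, sub_eq_add_neg]

lemma pow_pow_succ_eq {R : Type*} [Monoid R] (q : R) (k : ℕ) :
    (q ^ k) ^ (k + 1) = (q ^ 2) ^ (k + 1).choose 2 := by
  rw [← pow_mul, ← pow_mul, mul_comm k, mul_comm 2, ← Nat.add_one_mul_choose_eq k 1,
    Nat.choose_one_right]

lemma pow_pow_self_eq {R : Type*} [Monoid R] (q : R) (k : ℕ) :
    (q ^ k) ^ k = (q ^ 2) ^ k.choose 2 * q ^ k := by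
  cases k with
  | zero => simp
  | succ k =>
    rw [← pow_pow_succ_eq, ← pow_mul, ← pow_mul, ← pow_add]
    ring_nf

lemma tendsto_pow_mul_exp_neg_mul {N : ℕ → ℕ} (hN : Tendsto N atTop atTop) {c : ℝ} (hc : 0 < c)
    (j : ℕ) : Tendsto (fun m => ((N m : ℝ) * c) ^ j * Real.exp (-(N m * c))) atTop (𝓝 0) :=
  (Real.tendsto_pow_mul_exp_neg_atTop_nhds_zero j).comp
    ((tendsto_natCast_atTop_atTop.comp hN).atTop_mul_const hc)

lemma pow_div_factorial_mul_exp_neg_le {u y : ℝ} (hu : 0 < u) (hy : 0 ≤ y) {k : ℕ}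
    (h : 0 ≤ (1 - u) * (u * k - y)) :
    y ^ k / k.factorial * Real.exp (-y) ≤ (u * Real.exp (1 - u)) ^ k := by
  have hexp : y / u - y ≤ k * (1 - u) := by
    have heq : k * (1 - u) - (y / u - y) = (1 - u) * (u * k - y) / u := by field_simp
    exact sub_nonneg.1 (heq ▸ div_nonneg h hu.le)
  calc y ^ k / k.factorial * Real.exp (-y)
      = (y / u) ^ k / k.factorial * u ^ k * Real.exp (-y) := by
        rw [div_pow]
        field_simp
    _ ≤ Real.exp (y / u) * u ^ k * Real.exp (-y) := by
        gcongr
        exact Real.pow_div_factorial_le_exp _ (by positivity) k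
    _ = u ^ k * Real.exp (y / u - y) := by
        rw [sub_eq_add_neg, Real.exp_add]
        ring
    _ ≤ u ^ k * Real.exp (k * (1 - u)) := by gcongr
    _ = (u * Real.exp (1 - u)) ^ k := by rw [mul_pow, Real.exp_nat_mul]

lemma mul_exp_one_sub_lt_one {u : ℝ} (hu : u ≠ 1) : u * Real.exp (1 - u) < 1 := by
  have h : u < Real.exp (u - 1) := by linarith [Real.add_one_lt_exp (sub_ne_zero.2 hu)]
  calc u * Real.exp (1 - u) < Real.exp (u - 1) * Real.exp (1 - u) := by gcongr
    _ = 1 := by rw [← Real.exp_add, sub_add_sub_cancel, sub_self, Real.exp_zero]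

end Estimates

section Subcritical

variable {s r : ℝ}

lemma summable_pow_choose_two_mul_pow (hs0 : 0 < s) (hs1 : s < 1) (hr : 0 < r) :
    Summable fun k : ℕ => s ^ k.choose 2 * r ^ k := by
  have hratio : ∀ k : ℕ, s ^ k * r = ‖s ^ (k + 1).choose 2 * r ^ (k + 1)‖ /
      ‖s ^ k.choose 2 * r ^ k‖ := by
    intro k
    rw [Real.norm_of_nonneg (by positivity), Real.norm_of_nonneg (by positivity),
      Nat.choose_succ_succ' k 1, Nat.choose_one_right, pow_add, pow_succ]
    field_simp
  refine summable_of_ratio_test_tendsto_lt_one (l := 0) one_pos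
    (.of_forall fun k => by positivity) (Tendsto.congr hratio ?_)
  simpa only [zero_mul] using (tendsto_pow_atTop_nhds_zero_of_lt_one hs0.le hs1).mul_const r

variable {q : ℝ}

lemma choose_mul_pow_choose_two_le {t : ℝ} (ht : 0 ≤ t) (h0 : 0 < q) (h1 : q < 1) {n k : ℕ}
    (hk : k ≤ n) :
    n.choose k * (t ^ k.choose 2 * (1 - q ^ k) ^ (n - k)) ≤
      Real.exp (1 + 1 / (1 - q)) * ((t / q ^ 2) ^ k.choose 2 * (1 / q) ^ k) *
        ((n * q ^ k) ^ k / k.factorial * Real.exp (-(n * q ^ k))) := by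
  have hq : q ^ k ≤ 1 := pow_le_one₀ h0.le h1.le
  have hpow : t ^ k.choose 2 = (t / q ^ 2) ^ k.choose 2 * (1 / q) ^ k * (q ^ k) ^ k := by
    rw [pow_pow_self_eq, div_pow, one_div, inv_pow]
    field_simp
  calc n.choose k * (t ^ k.choose 2 * (1 - q ^ k) ^ (n - k))
      ≤ ((n : ℝ) ^ k / k.factorial) *
          (t ^ k.choose 2 * (Real.exp (1 + 1 / (1 - q)) * Real.exp (-(n * q ^ k)))) := by
        gcongr
        · exact Nat.choose_le_pow_div k n
        · exact one_sub_pow_pow_le h0.le h1 hk (by omega)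
    _ = _ := by
        rw [hpow, mul_pow]
        ring

lemma tendsto_sum_choose_mul_pow_choose_two {t : ℝ} (ht : 0 < t) (h0 : 0 < q) (h1 : q < 1)
    (htq : t < q ^ 2) :
    Tendsto (fun n : ℕ => ∑ k ∈ Finset.range (n + 1),
      (n.choose k : ℝ) * (t ^ k.choose 2 * (1 - q ^ k) ^ (n - k))) atTop (𝓝 0) := by
  have hnonneg : ∀ n k : ℕ, 0 ≤ (n.choose k : ℝ) * (t ^ k.choose 2 * (1 - q ^ k) ^ (n - k)) := by
    intro n k
    have hq : 0 ≤ 1 - q ^ k := sub_nonneg.2 (pow_le_one₀ h0.le h1.le)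
    positivity
  set C : ℝ := Real.exp (1 + 1 / (1 - q))
  have hb := (summable_pow_choose_two_mul_pow (s := t / q ^ 2) (by positivity)
    ((div_lt_one (by positivity)).2 htq) (one_div_pos.2 h0)).mul_left C
  refine tendsto_sum_range_of_dominated hb (fun k => by positivity)
    (.of_forall fun n k hk => ?_) fun k => ?_
  · rw [abs_of_nonneg (hnonneg n k)]
    refine (choose_mul_pow_choose_two_le ht.le h0 h1 hk).trans
      (mul_le_of_le_one_right (by positivity) ?_)
    simpa using pow_div_factorial_mul_exp_neg_le (y := n * q ^ k) (k := k) one_pos (by positivity)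
  · have hlim := (tendsto_pow_mul_exp_neg_mul tendsto_id (pow_pos h0 k) k).const_mul
      (C * ((t / q ^ 2) ^ k.choose 2 * (1 / q) ^ k) / k.factorial)
    rw [mul_zero] at hlim
    refine squeeze_zero' (.of_forall fun n => hnonneg n k) ?_ hlim
    filter_upwards [eventually_ge_atTop k] with n hn
    refine (choose_mul_pow_choose_two_le ht.le h0 h1 hn).trans_eq ?_
    simp only [id_eq]
    ring

theorem tendsto_prob_phiC1 {p : I} (hp0 : 0 < (p : ℝ)) (hp1 : (p : ℝ) < 1)
    (hp : (p : ℝ) < (1 - p) ^ 2) : Tendsto (fun n => prob n p PhiC1) atTop (𝓝 1) :=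
  tendsto_prob_one (N := id) (Q := fun _ => PhiC1)
    (tendsto_sum_choose_mul_pow_choose_two hp0 (sub_pos.2 hp1) (by linarith) hp)
    fun n => (real_not_phiC1_le p).trans_eq (by rw [Fintype.card_fin, id_eq])

end Subcritical

section CriticalSparse

variable {q : ℝ}

lemma choose_mul_sub_mul_pow_le (h0 : 0 ≤ q) (h1 : q < 1) {n k : ℕ} (hk : k ≤ n) :
    n.choose k * ((n - k : ℕ) * ((q ^ 2) ^ (k + 1).choose 2 * (1 - q ^ k) ^ (n - (k + 1)))) ≤
      Real.exp (1 + 1 / (1 - q)) *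
        ((k + 1) * ((n * q ^ k) ^ (k + 1) / (k + 1).factorial * Real.exp (-(n * q ^ k)))) := by
  rcases hk.eq_or_lt with rfl | hlt
  · rw [Nat.sub_self, Nat.cast_zero, zero_mul, mul_zero]
    positivity
  have hq : q ^ k ≤ 1 := pow_le_one₀ h0 h1.le
  have hchoose : (n.choose k : ℝ) * (n - k : ℕ) = n.choose (k + 1) * (k + 1) := by
    exact_mod_cast (Nat.choose_succ_right_eq n k).symm
  rw [← mul_assoc, hchoose, ← pow_pow_succ_eq]
  calc _ ≤ ((n : ℝ) ^ (k + 1) / (k + 1).factorial) * (k + 1) * ((q ^ k) ^ (k + 1) *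
        (Real.exp (1 + 1 / (1 - q)) * Real.exp (-(n * q ^ k)))) := by
        gcongr
        · exact Nat.choose_le_pow_div (k + 1) n
        · exact one_sub_pow_pow_le h0 h1 hlt le_rfl
    _ = _ := by
        rw [mul_pow]
        ring

/-- The orders `≈ (m + 1) q^(-m - 1/2)`, along which, at the critical density, the expected number
of witnesses of every size is negligible. -/
noncomputable def sparseOrder (q : ℝ) (m : ℕ) : ℕ := ⌈(m + 1) / (√q * q ^ m)⌉₊

section SparseOrder

variable (h0 : 0 < q) (h1 : q < 1)

include h0 h1

lemma tendsto_sparseOrder : Tendsto (sparseOrder q) atTop atTop := by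
  refine tendsto_atTop_mono (fun m => ?_) tendsto_id
  have hden : √q * q ^ m ≤ 1 := mul_le_one₀ (Real.sqrt_le_one.2 h1.le) (by positivity)
    (pow_le_one₀ h0.le h1.le)
  have h : (m : ℝ) ≤ (m + 1) / (√q * q ^ m) := by
    rw [le_div_iff₀ (by positivity)]
    nlinarith
  exact Nat.cast_le.1 (h.trans (Nat.le_ceil _))

lemma inv_sqrt_mul_le_sparseOrder_mul {m k : ℕ} (hk : k ≤ m) :
    (√q)⁻¹ * (k + 1) ≤ sparseOrder q m * q ^ k := by
  calc (√q)⁻¹ * (k + 1) ≤ (√q)⁻¹ * (m + 1) := by gcongr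
    _ = (m + 1) / (√q * q ^ m) * q ^ m := by field_simp
    _ ≤ sparseOrder q m * q ^ k := by
        gcongr ?_ * ?_
        · exact Nat.le_ceil _
        · exact pow_le_pow_of_le_one h0.le h1.le hk

lemma sparseOrder_mul_le_sqrt_mul {m k : ℕ} (hk : m < k) :
    sparseOrder q m * q ^ k ≤ √q * (k + 1) := by
  have hq : q ≤ √q := Real.le_sqrt_of_sq_le (by nlinarith)
  have hle : q ^ k ≤ q ^ (m + 1) := pow_le_pow_of_le_one h0.le h1.le hk
  have hceil : (sparseOrder q m : ℝ) ≤ (m + 1) / (√q * q ^ m) + 1 :=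
    (Nat.ceil_lt_add_one (by positivity)).le
  calc sparseOrder q m * q ^ k ≤ ((m + 1) / (√q * q ^ m) + 1) * q ^ k := by gcongr
    _ ≤ (m + 1) / (√q * q ^ m) * q ^ (m + 1) + √q := by
        rw [add_mul, one_mul]
        gcongr
        exact (pow_le_of_le_one h0.le h1.le (by omega)).trans hq
    _ = √q * ((m + 1 : ℕ) + 1) := by
        rw [pow_succ]
        field_simp
        rw [Real.sq_sqrt h0.le]
        push_cast
        ring
    _ ≤ √q * (k + 1) := by gcongr; exact hk

lemma sparseOrder_pow_div_factorial_le (m k : ℕ) :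
    (sparseOrder q m * q ^ k) ^ (k + 1) / (k + 1).factorial *
        Real.exp (-(sparseOrder q m * q ^ k)) ≤
      (√q * Real.exp (1 - √q)) ^ (k + 1) + ((√q)⁻¹ * Real.exp (1 - (√q)⁻¹)) ^ (k + 1) := by
  have hu0 : 0 < √q := Real.sqrt_pos.2 h0
  have hu1 : √q ≤ 1 := Real.sqrt_le_one.2 h1.le
  have hy : 0 ≤ sparseOrder q m * q ^ k := by positivity
  rcases le_or_gt k m with hk | hk
  · refine (pow_div_factorial_mul_exp_neg_le (inv_pos.2 hu0) hy ?_).trans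
      (le_add_of_nonneg_left (by positivity))
    refine mul_nonneg_of_nonpos_of_nonpos (sub_nonpos.2 ((one_le_inv₀ hu0).2 hu1)) ?_
    simpa using inv_sqrt_mul_le_sparseOrder_mul h0 h1 hk
  · refine (pow_div_factorial_mul_exp_neg_le hu0 hy ?_).trans
      (le_add_of_nonneg_right (by positivity))
    refine mul_nonneg (sub_nonneg.2 hu1) ?_
    simpa using sparseOrder_mul_le_sqrt_mul h0 h1 hk

lemma tendsto_sum_sparseOrder :
    Tendsto (fun m => ∑ k ∈ Finset.range (sparseOrder q m + 1),
      (k + 1) * ((sparseOrder q m * q ^ k) ^ (k + 1) / (k + 1).factorial *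
        Real.exp (-(sparseOrder q m * q ^ k)))) atTop (𝓝 0) := by
  have hu0 : 0 < √q := Real.sqrt_pos.2 h0
  have hu1 : √q ≠ 1 := by rw [Ne, Real.sqrt_eq_one]; exact h1.ne
  have hsum : ∀ u : ℝ, 0 < u → u ≠ 1 →
      Summable fun k : ℕ => ((k : ℝ) + 1) * (u * Real.exp (1 - u)) ^ (k + 1) := by
    intro u hu hu1
    have hlt : ‖u * Real.exp (1 - u)‖ < 1 := by
      rw [Real.norm_of_nonneg (by positivity)]
      exact mul_exp_one_sub_lt_one hu1
    have hgeom := summable_pow_mul_geometric_of_norm_lt_one 1 hlt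
    simpa only [pow_one, Nat.cast_add_one] using (summable_nat_add_iff 1).2 hgeom
  refine tendsto_sum_range_of_dominated
    ((hsum _ hu0 hu1).add (hsum _ (inv_pos.2 hu0) (inv_ne_one.2 hu1))) (fun k => by positivity)
    (.of_forall fun m k _ => ?_) fun k => ?_
  · rw [abs_of_nonneg (by positivity), ← mul_add]
    gcongr
    exact sparseOrder_pow_div_factorial_le h0 h1 m k
  · have hlim := (tendsto_pow_mul_exp_neg_mul (tendsto_sparseOrder h0 h1) (pow_pos h0 k)
      (k + 1)).const_mul ((k + 1) / (k + 1).factorial : ℝ)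
    rw [mul_zero] at hlim
    refine hlim.congr fun m => ?_
    ring

end SparseOrder

theorem tendsto_prob_phiC3_sparseOrder {p : I} (hp0 : 0 < (p : ℝ)) (hp1 : (p : ℝ) < 1)
    (hp : (p : ℝ) = (1 - p) ^ 2) :
    Tendsto (fun m => prob (sparseOrder (1 - p) m) p PhiC3) atTop (𝓝 1) := by
  have hq0 : 0 < 1 - (p : ℝ) := sub_pos.2 hp1
  have hq1 : 1 - (p : ℝ) < 1 := by linarith
  have hlim := (tendsto_sum_sparseOrder hq0 hq1).const_mul (Real.exp (1 + 1 / (1 - (1 - p : ℝ))))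
  rw [mul_zero] at hlim
  refine tendsto_prob_one (Q := fun _ => PhiC3) hlim fun m => (real_not_phiC3_le p).trans ?_
  rw [Fintype.card_fin, Finset.mul_sum]
  refine Finset.sum_le_sum fun k hk => ?_
  have hle := choose_mul_sub_mul_pow_le hq0.le hq1 (Finset.mem_range_succ_iff.1 hk)
  rwa [← hp] at hle

end CriticalSparse

section Counting

variable {V : Type*} [DecidableEq V] {S X : Finset V}

lemma card_filter_card_inter_le (hX : X ⊆ S) (k l : ℕ) :
    ((S.powersetCard k).filter fun Y => (X ∩ Y).card = l).card ≤
      X.card.choose l * (S.card - X.card).choose (k - l) := by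
  rw [← Finset.card_sdiff_of_subset hX, ← Finset.card_powersetCard, ← Finset.card_powersetCard,
    ← Finset.card_product]
  refine Finset.card_le_card_of_injOn (fun Y => (X ∩ Y, Y \ X)) ?_ ?_
  · intro Y hY
    simp only [Finset.coe_filter, Finset.mem_powersetCard, Set.mem_ofPred_eq] at hY
    obtain ⟨⟨hYS, hYk⟩, hl⟩ := hY
    simp only [Finset.coe_product, Set.mem_prod, Finset.mem_coe, Finset.mem_powersetCard]
    refine ⟨⟨Finset.inter_subset_left, hl⟩, Finset.sdiff_subset_sdiff hYS le_rfl, ?_⟩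
    rw [Finset.card_sdiff, hYk, hl]
  · intro Y _ Z _ h
    simp only [Prod.mk.injEq] at h
    rw [← Finset.sdiff_union_inter Y X, ← Finset.sdiff_union_inter Z X, h.2,
      Finset.inter_comm Y, h.1, Finset.inter_comm X]

lemma sum_erase_card_inter_le {k : ℕ} (hX : X ∈ S.powersetCard k) {f : ℕ → ℝ}
    (hf : ∀ l, 0 ≤ f l) :
    ∑ Y ∈ (S.powersetCard k).erase X, f (X ∩ Y).card ≤
      ∑ l ∈ Finset.range k, (k.choose l * (S.card - k).choose (k - l) : ℕ) * f l := by
  obtain ⟨hXS, hXk⟩ := Finset.mem_powersetCard.1 hX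
  have hmap : ∀ Y ∈ (S.powersetCard k).erase X, (X ∩ Y).card ∈ Finset.range k := by
    intro Y hY
    obtain ⟨hne, hY⟩ := Finset.mem_erase.1 hY
    have hYk := (Finset.mem_powersetCard.1 hY).2
    rw [Finset.mem_range, ← hXk]
    refine Finset.card_lt_card (Finset.inter_subset_left.ssubset_of_ne fun h => hne ?_)
    exact (Finset.eq_of_subset_of_card_le (Finset.inter_eq_left.1 h) (by rw [hXk, hYk])).symm
  rw [← Finset.sum_fiberwise_of_maps_to hmap]
  refine Finset.sum_le_sum fun l _ => ?_
  rw [Finset.sum_congr rfl (g := fun _ => f l) fun Y hY => by rw [(Finset.mem_filter.1 hY).2],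
    Finset.sum_const, nsmul_eq_mul]
  refine mul_le_mul_of_nonneg_right (Nat.cast_le.2 ?_) (hf l)
  exact (Finset.card_le_card (Finset.filter_subset_filter _ (Finset.erase_subset _ _))).trans
    (hXk ▸ card_filter_card_inter_le hXS X.card l)

lemma sum_card_inter_le {k : ℕ} (hX : X ∈ S.powersetCard k) {f : ℕ → ℝ} (hf : ∀ l, 0 ≤ f l) :
    ∑ Y ∈ S.powersetCard k, f (X ∩ Y).card ≤
      ∑ l ∈ Finset.range (k + 1), (k.choose l * (S.card - k).choose (k - l) : ℕ) * f l := by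
  rw [← Finset.sum_erase_add _ _ hX, Finset.inter_self, (Finset.mem_powersetCard.1 hX).2,
    Finset.sum_range_succ, Nat.choose_self, Nat.sub_self, Nat.choose_zero_right, mul_one,
    Nat.cast_one, one_mul]
  exact add_le_add_left (sum_erase_card_inter_le hX hf) _

lemma choose_sub_mul_pow_le {m k l : ℕ} (hl : l ≤ k) :
    m.choose (k - l) * (m - k) ^ l ≤ m.choose k * k ^ l := by
  induction l with
  | zero => simp
  | succ l ih =>
    obtain ⟨j, rfl⟩ : ∃ j, k = j + 1 + l := ⟨k - (l + 1), by omega⟩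
    have hsucc := ih (by omega)
    rw [show j + 1 + l - l = j + 1 by omega] at hsucc
    rw [show j + 1 + l - (l + 1) = j by omega]
    calc m.choose j * (m - (j + 1 + l)) ^ (l + 1)
        ≤ m.choose j * ((m - j) * (m - (j + 1 + l)) ^ l) := by
          rw [pow_succ']
          gcongr
          omega
      _ = (m.choose (j + 1) * (m - (j + 1 + l)) ^ l) * (j + 1) := by
          rw [← mul_assoc, ← Nat.choose_succ_right_eq]
          ring
      _ ≤ (m.choose (j + 1 + l) * (j + 1 + l) ^ l) * (j + 1 + l) :=
          Nat.mul_le_mul hsucc (by omega)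
      _ = _ := by ring

lemma choose_mul_choose_le {m k l : ℕ} (hl : l ≤ k) (hk : k < m) :
    ((k.choose l * (m - k).choose (k - l) : ℕ) : ℝ) ≤
      m.choose k * ((k : ℝ) ^ 2 / (m - k)) ^ l := by
  have hmk : (0 : ℝ) < m - k := sub_pos.2 (Nat.cast_lt.2 hk)
  have hsub : (m.choose (k - l) : ℝ) * ((m : ℝ) - k) ^ l ≤ m.choose k * (k : ℝ) ^ l := by
    rw [← Nat.cast_sub hk.le]
    exact_mod_cast choose_sub_mul_pow_le hl
  calc ((k.choose l * (m - k).choose (k - l) : ℕ) : ℝ) ≤ (k : ℝ) ^ l * m.choose (k - l) := by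
        exact_mod_cast Nat.mul_le_mul (Nat.choose_le_pow k l)
          (Nat.choose_le_choose _ (Nat.sub_le m k))
    _ ≤ (k : ℝ) ^ l * (m.choose k * (k : ℝ) ^ l / ((m : ℝ) - k) ^ l) := by
        gcongr
        rwa [le_div_iff₀ (by positivity)]
    _ = _ := by
        rw [div_pow]
        ring

end Counting

section SupercriticalSecondMoment

lemma sqrt_pow_pow_le_pow_choose_two {t : ℝ} (h0 : 0 ≤ t) (h1 : t ≤ 1) {k l : ℕ} (hl : l ≤ k) :
    (√t ^ k) ^ l ≤ t ^ l.choose 2 := by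
  have hs : √t ≤ 1 := Real.sqrt_le_one.2 h1
  calc (√t ^ k) ^ l ≤ (√t ^ l) ^ l :=
        pow_le_pow_left₀ (by positivity) (pow_le_pow_of_le_one (Real.sqrt_nonneg t) hs hl) l
    _ = t ^ l.choose 2 * √t ^ l := by rw [pow_pow_self_eq, Real.sq_sqrt h0]
    _ ≤ t ^ l.choose 2 :=
        mul_le_of_le_one_right (by positivity) (pow_le_one₀ (Real.sqrt_nonneg t) hs)

lemma sum_overlap_le_choose_mul {t r β : ℝ} (ht0 : 0 < t) (ht1 : t ≤ 1) (hr : 0 < r) {m k : ℕ}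
    (hk : k < m) (hβ : (k : ℝ) ^ 2 / ((m - k) * (r * √t ^ k)) ≤ β) (hβ1 : β < 1) :
    ∑ l ∈ Finset.range (k + 1), (k.choose l * (m - k).choose (k - l) : ℕ) *
      (t ^ l.choose 2 * r ^ l)⁻¹ ≤ m.choose k * (1 - β)⁻¹ := by
  have hmk : (0 : ℝ) < m - k := sub_pos.2 (Nat.cast_lt.2 hk)
  have hβ0 : 0 ≤ β := le_trans (by positivity) hβ
  have hgeom : ∑ l ∈ Finset.range (k + 1), β ^ l ≤ (1 - β)⁻¹ := by
    rw [← tsum_geometric_of_lt_one hβ0 hβ1]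
    exact (summable_geometric_of_lt_one hβ0 hβ1).sum_le_tsum _ fun l _ => pow_nonneg hβ0 l
  refine le_trans ?_ (mul_le_mul_of_nonneg_left hgeom (Nat.cast_nonneg _))
  rw [Finset.mul_sum]
  refine Finset.sum_le_sum fun l hl => ?_
  have hlk : l ≤ k := Finset.mem_range_succ_iff.1 hl
  calc _ ≤ (m.choose k * ((k : ℝ) ^ 2 / (m - k)) ^ l) * ((√t ^ k) ^ l * r ^ l)⁻¹ := by
        gcongr
        · exact choose_mul_choose_le hlk hk
        · exact sqrt_pow_pow_le_pow_choose_two ht0.le ht1 hlk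
    _ = m.choose k * ((k : ℝ) ^ 2 / ((m - k) * (r * √t ^ k))) ^ l := by
        rw [div_pow, div_pow, mul_pow, mul_pow]
        field_simp
    _ ≤ m.choose k * β ^ l := by gcongr

lemma one_sub_mul_le_one_sub_pow {x : ℝ} (h0 : 0 ≤ x) (h1 : x ≤ 1) {j N : ℕ} (hj : j ≤ N) :
    1 - N * x ≤ (1 - x) ^ j := by
  have hjN : (j : ℝ) * x ≤ N * x := by gcongr
  have hbernoulli := one_add_mul_le_pow (a := -x) (by linarith) j
  rw [← sub_eq_add_neg] at hbernoulli
  linarith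

variable {V : Type*} [Fintype V] [DecidableEq V] {p : I}

lemma real_witnessEvent_inter_le (hp0 : 0 < (p : ℝ)) (hp1 : (p : ℝ) < 1) (b : Bool) {v : V} {k : ℕ}
    {X Y : Finset V} (hX : X ∈ ({v}ᶜ : Finset V).powersetCard k)
    (hY : Y ∈ ({v}ᶜ : Finset V).powersetCard k) :
    G(V, p).real (witnessEvent b v X ∩ witnessEvent b v Y) ≤
      ((p : ℝ) ^ k.choose 2 * edgeProb p b ^ k) ^ 2 *
        ((p : ℝ) ^ (X ∩ Y).card.choose 2 * edgeProb p b ^ (X ∩ Y).card)⁻¹ := by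
  have hr0 := edgeProb_pos hp0 hp1 b
  obtain ⟨hXv, hXk⟩ := Finset.mem_powersetCard.1 hX
  obtain ⟨hYv, hYk⟩ := Finset.mem_powersetCard.1 hY
  rw [Finset.subset_compl_singleton] at hXv hYv
  have hinter := real_rootedEvent_inter p b hXv hYv
  rw [hXk, hYk] at hinter
  rw [← div_eq_mul_inv, le_div_iff₀ (by positivity), sq, ← hinter]
  gcongr
  exacts [measure_ne_top _ _, Set.inter_subset_left, Set.inter_subset_left]

lemma le_real_biUnion_witnessEvent (hp0 : 0 < (p : ℝ)) (hp1 : (p : ℝ) < 1) (b : Bool) (v : V)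
    {n k : ℕ} (hV : Fintype.card V = n + 1) (hk : k < n) {β : ℝ} (hβ1 : β < 1)
    (hβ : (k : ℝ) ^ 2 / ((n - k) * (edgeProb p b * √p ^ k)) ≤ β)
    (hr : (n + 1) * edgeProb p (!b) ^ k < 1) :
    (1 - (n + 1) * edgeProb p (!b) ^ k) ^ 2 * (1 - β) ≤
      G(V, p).real (⋃ X ∈ ({v}ᶜ : Finset V).powersetCard k, witnessEvent b v X) := by
  have hS : ({v}ᶜ : Finset V).card = n := by rw [Finset.card_compl, hV, Finset.card_singleton]; rfl
  have hr0 := edgeProb_pos hp0 hp1 b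
  obtain ⟨hr'0, hr'1⟩ := edgeProb_mem_Icc p (!b)
  set a := (p : ℝ) ^ k.choose 2 * edgeProb p b ^ k
  set w := (1 - edgeProb p (!b) ^ k) ^ (n - k)
  have ha0 : 0 < a := by positivity
  have hle : 1 - (n + 1) * edgeProb p (!b) ^ k ≤ w := by
    exact_mod_cast one_sub_mul_le_one_sub_pow (N := n + 1) (pow_nonneg hr'0 k)
      (pow_le_one₀ hr'0 hr'1) (by omega)
  have hw0 : 0 < w := (sub_pos.2 hr).trans_le hle
  have hβ0 : 0 < 1 - β := sub_pos.2 hβ1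
  have hone := one_le_mul_measureReal_biUnion (μ := G(V, p)) (a := a * w)
    (K := (w ^ 2 * (1 - β))⁻¹) (A := witnessEvent b v) (s := ({v}ᶜ : Finset V).powersetCard k)
    (fun _ _ => .of_discrete) (Finset.powersetCard_nonempty.2 (by omega)) (by positivity)
    (fun X hX => ?_) (fun X hX => ?_)
  · rw [inv_mul_eq_div, one_le_div (by positivity)] at hone
    exact le_trans (by gcongr) hone
  · obtain ⟨hXv, hXk⟩ := Finset.mem_powersetCard.1 hX
    rw [real_witnessEvent p b (Finset.subset_compl_singleton.1 hXv), hXk, hV,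
      Nat.add_sub_add_right]
  · calc _ ≤ ∑ Y ∈ ({v}ᶜ : Finset V).powersetCard k, a ^ 2 *
          ((p : ℝ) ^ (X ∩ Y).card.choose 2 * edgeProb p b ^ (X ∩ Y).card)⁻¹ :=
          Finset.sum_le_sum fun Y hY => real_witnessEvent_inter_le hp0 hp1 b hX hY
      _ ≤ a ^ 2 * (n.choose k * (1 - β)⁻¹) := by
          rw [← Finset.mul_sum]
          gcongr
          refine (sum_card_inter_le hX (f := fun l => ((p : ℝ) ^ l.choose 2 *
            edgeProb p b ^ l)⁻¹) fun l => by positivity).trans ?_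
          rw [hS]
          exact sum_overlap_le_choose_mul hp0 hp1.le hr0 hk hβ hβ1
      _ = _ := by
          rw [Finset.card_powersetCard, hS]
          field_simp

end SupercriticalSecondMoment

section Supercritical

/-- The largest `k` with `a ^ k ≤ n`: the size of the cliques that witness the failure of the three
sentences above the critical density, for a suitable base `a`. -/
noncomputable def cliqueSize (a : ℝ) (n : ℕ) : ℕ := ⌊Real.logb a n⌋₊

section CliqueSize

variable {a : ℝ} (ha : 1 < a)

include ha

lemma tendsto_cliqueSize : Tendsto (cliqueSize a) atTop atTop :=
  tendsto_nat_floor_atTop.comp ((Real.tendsto_logb_atTop ha).comp tendsto_natCast_atTop_atTop)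

lemma pow_cliqueSize_le {n : ℕ} (hn : n ≠ 0) : a ^ cliqueSize a n ≤ n := by
  have hn1 : (1 : ℝ) ≤ n := Nat.one_le_cast.2 (Nat.one_le_iff_ne_zero.2 hn)
  rw [← Real.rpow_natCast, ← Real.le_logb_iff_rpow_le ha (by linarith)]
  exact Nat.floor_le (Real.logb_nonneg ha hn1)

lemma lt_pow_cliqueSize_add_one {n : ℕ} (hn : n ≠ 0) : n < a ^ (cliqueSize a n + 1) := by
  rw [← Real.rpow_natCast, ← Real.logb_lt_iff_lt_rpow ha (by positivity), Nat.cast_add_one]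
  exact Nat.lt_floor_add_one _

lemma tendsto_mul_pow_cliqueSize {r : ℝ} (hr0 : 0 ≤ r) (hr1 : a * r < 1) :
    Tendsto (fun n : ℕ => ((n : ℝ) + 1) * r ^ cliqueSize a n) atTop (𝓝 0) := by
  have hlim := ((tendsto_pow_atTop_nhds_zero_of_lt_one (by positivity) hr1).comp
    (tendsto_cliqueSize ha)).const_mul (2 * a)
  rw [mul_zero] at hlim
  refine squeeze_zero' (.of_forall fun n => by positivity) ?_ hlim
  filter_upwards [eventually_ge_atTop 1] with n hn
  have hn1 : (1 : ℝ) ≤ n := Nat.one_le_cast.2 hn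
  have hlt := lt_pow_cliqueSize_add_one ha (Nat.one_le_iff_ne_zero.1 hn)
  calc ((n : ℝ) + 1) * r ^ cliqueSize a n
      ≤ (2 * a ^ (cliqueSize a n + 1)) * r ^ cliqueSize a n := by
        gcongr
        linarith
    _ = 2 * a * (a * r) ^ cliqueSize a n := by
        rw [mul_pow]
        ring

lemma eventually_two_mul_cliqueSize_le : ∀ᶠ n : ℕ in atTop, 2 * (cliqueSize a n : ℝ) ≤ n := by
  have hlim := ((tendsto_pow_const_mul_const_pow_of_lt_one 1 (inv_nonneg.2 (by positivity))
    (inv_lt_one_of_one_lt₀ ha)).comp (tendsto_cliqueSize ha))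
  filter_upwards [hlim.eventually_le_const one_half_pos, eventually_ne_atTop 0] with n hn hn0
  refine le_trans ?_ (pow_cliqueSize_le ha hn0)
  simp only [Function.comp_apply, pow_one, inv_pow, ← div_eq_mul_inv] at hn
  rw [div_le_iff₀ (by positivity)] at hn
  linarith

lemma tendsto_sq_div_cliqueSize {r s : ℝ} (hr : 0 < r) (hs : 0 < s) (has : 1 < a * s) :
    Tendsto (fun n : ℕ => (cliqueSize a n : ℝ) ^ 2 /
      ((n - cliqueSize a n) * (r * s ^ cliqueSize a n))) atTop (𝓝 0) := by
  have hlim := ((tendsto_pow_const_mul_const_pow_of_lt_one 2 (inv_nonneg.2 (by positivity))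
    (inv_lt_one_of_one_lt₀ has)).comp (tendsto_cliqueSize ha)).const_mul (2 / r)
  rw [mul_zero] at hlim
  refine squeeze_zero' ?_ ?_ hlim
  · filter_upwards [eventually_two_mul_cliqueSize_le ha] with n hn
    have hsub : (0 : ℝ) ≤ n - cliqueSize a n := by
      linarith [Nat.cast_nonneg (α := ℝ) (cliqueSize a n)]
    positivity
  · filter_upwards [eventually_two_mul_cliqueSize_le ha, eventually_ne_atTop 0] with n hn hn0
    have hle := pow_cliqueSize_le ha hn0
    calc (cliqueSize a n : ℝ) ^ 2 / ((n - cliqueSize a n) * (r * s ^ cliqueSize a n))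
        ≤ (cliqueSize a n : ℝ) ^ 2 / ((a ^ cliqueSize a n / 2) * (r * s ^ cliqueSize a n)) := by
          gcongr
          linarith
      _ = _ := by
          rw [Function.comp_apply, inv_pow, mul_pow]
          field_simp

end CliqueSize

variable {p : I}

lemma tendsto_real_biUnion_witnessEvent (hp0 : 0 < (p : ℝ)) (hp1 : (p : ℝ) < 1) (b : Bool) {a : ℝ}
    (ha : 1 < a) (har : a * edgeProb p (!b) < 1) (has : 1 < a * √p) :
    Tendsto (fun n => G(Fin (n + 1), p).real
      (⋃ X ∈ ({0}ᶜ : Finset (Fin (n + 1))).powersetCard (cliqueSize a n), witnessEvent b 0 X))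
      atTop (𝓝 1) := by
  have hmul := tendsto_mul_pow_cliqueSize ha (edgeProb_pos hp0 hp1 (!b)).le har
  have hoverlap := tendsto_sq_div_cliqueSize ha (edgeProb_pos hp0 hp1 b) (Real.sqrt_pos.2 hp0) has
  have hlower := ((hmul.const_sub 1).pow 2).mul (hoverlap.const_sub 1)
  simp only [sub_zero, one_pow, mul_one] at hlower
  refine tendsto_of_tendsto_of_tendsto_of_le_of_le' hlower tendsto_const_nhds ?_
    (.of_forall fun n => measureReal_le_one)
  filter_upwards [hmul.eventually_lt_const one_pos, hoverlap.eventually_lt_const one_pos,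
    eventually_two_mul_cliqueSize_le ha, eventually_gt_atTop 0] with n hr hβ hn hn0
  refine le_real_biUnion_witnessEvent hp0 hp1 b 0 (Fintype.card_fin _) ?_ hβ le_rfl hr
  have hle : 2 * cliqueSize a n ≤ n := by exact_mod_cast hn
  omega

lemma tendsto_prob_and {Q R : ∀ n, SimpleGraph (Fin n) → Prop}
    (hQ : Tendsto (fun n => prob n p (Q n)) atTop (𝓝 1))
    (hR : Tendsto (fun n => prob n p (R n)) atTop (𝓝 1)) :
    Tendsto (fun n => prob n p fun G => Q n G ∧ R n G) atTop (𝓝 1) := by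
  have hlower := (hQ.add hR).sub_const 1
  rw [add_sub_cancel_right] at hlower
  refine tendsto_of_tendsto_of_tendsto_of_le_of_le hlower tendsto_const_nhds (fun n => ?_)
    fun n => measureReal_le_one
  have hadd := measureReal_union_add_inter (μ := G(Fin n, p)) (s := {G | Q n G}) (t := {G | R n G})
    .of_discrete
  have hone := measureReal_le_one (μ := G(Fin n, p)) (s := {G | Q n G} ∪ {G | R n G})
  calc prob n p (Q n) + prob n p (R n) - 1
      ≤ G(Fin n, p).real ({G | Q n G} ∩ {G | R n G}) := by
        rw [prob, prob]
        linarith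
    _ = _ := rfl

lemma exists_base_of_one_sub_sq_lt {t : ℝ} (h0 : 0 < t) (h1 : t < 1) (ht : (1 - t) ^ 2 < t) :
    ∃ a, 1 < a ∧ a * t < 1 ∧ a * (1 - t) < 1 ∧ 1 < a * √t := by
  have hs1 : √t < 1 := (Real.sqrt_lt' one_pos).2 (by simpa using h1)
  have hts : max t (1 - t) < √t := max_lt (Real.lt_sqrt_of_sq_lt (by nlinarith))
    (Real.lt_sqrt_of_sq_lt ht)
  obtain ⟨c, htc, hcs⟩ := exists_between hts
  obtain ⟨htc, htc'⟩ := max_lt_iff.1 htc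
  have hc : 0 < c := h0.trans htc
  refine ⟨c⁻¹, (one_lt_inv₀ hc).2 (hcs.trans hs1), ?_, ?_, ?_⟩
  · rwa [inv_mul_lt_one₀ hc]
  · rwa [inv_mul_lt_one₀ hc]
  · rwa [one_lt_inv_mul₀ hc]

theorem tendsto_prob_not_phiC (hp0 : 0 < (p : ℝ)) (hp1 : (p : ℝ) < 1) (hp : (1 - p : ℝ) ^ 2 < p) :
    Tendsto (fun n => prob n p fun G => ¬ PhiC1 G ∧ ¬ PhiC2 G ∧ ¬ PhiC3 G) atTop (𝓝 1) := by
  obtain ⟨a, ha, hap, haq, has⟩ := exists_base_of_one_sub_sq_lt hp0 hp1 hp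
  have hnonempty : ∀ᶠ n in atTop, ∀ X ∈ ({0}ᶜ : Finset (Fin (n + 1))).powersetCard
      (cliqueSize a n), X.Nonempty ∧ 0 ∉ X := by
    filter_upwards [(tendsto_cliqueSize ha).eventually_ge_atTop 1] with n hn X hX
    obtain ⟨hX0, hXk⟩ := Finset.mem_powersetCard.1 hX
    exact ⟨Finset.card_pos.1 (hXk ▸ hn), Finset.subset_compl_singleton.1 hX0⟩
  have hlim : ∀ b : Bool, a * edgeProb p (!b) < 1 → ∀ Q : ∀ n, SimpleGraph (Fin n) → Prop,
      (∀ n G, Q n G ↔ ∃ (v : Fin n) (X : Finset (Fin n)), X.Nonempty ∧ v ∉ X ∧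
        G ∈ witnessEvent b v X) → Tendsto (fun n => prob n p (Q n)) atTop (𝓝 1) := by
    intro b hb Q hQ
    rw [← tendsto_add_atTop_iff_nat 1]
    refine tendsto_of_tendsto_of_tendsto_of_le_of_le'
      (tendsto_real_biUnion_witnessEvent hp0 hp1 b ha hb has) tendsto_const_nhds ?_
      (.of_forall fun n => measureReal_le_one)
    filter_upwards [hnonempty] with n hn
    refine measureReal_mono fun G hG => (hQ (n + 1) G).2 ?_
    obtain ⟨X, hX, hG⟩ := Set.mem_iUnion₂.1 hG
    exact ⟨0, X, (hn X hX).1, (hn X hX).2, hG⟩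
  have hC2 := hlim false hap (fun _ G => ¬ PhiC2 G) fun _ _ => not_phiC2_iff
  have hC3 := hlim true haq (fun _ G => ¬ PhiC3 G) fun _ _ => not_phiC3_iff
  refine (tendsto_prob_and hC2 hC3).congr fun n => ?_
  have hiff : ∀ G : SimpleGraph (Fin n),
      (¬ PhiC2 G ∧ ¬ PhiC3 G) ↔ ¬ PhiC1 G ∧ ¬ PhiC2 G ∧ ¬ PhiC3 G := fun G =>
    (and_iff_right_of_imp fun h => mt PhiC1.phiC3 h.2).symm
  exact congrArg (prob n p) (funext fun G => propext (hiff G))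

end Supercritical

section CriticalDense

lemma exp_mul_factorial_succ_le (k : ℕ) :
    Real.exp k * ((k + 1).factorial : ℝ) ≤ ((k : ℝ) + 1) ^ (k + 2) := by
  induction k with
  | zero => simp
  | succ k ih =>
    have hratio : Real.exp 1 * ((k : ℝ) + 1) ^ (k + 2) ≤ ((k : ℝ) + 2) ^ (k + 2) := by
      have hexp := Real.one_sub_div_pow_le_exp_neg (n := k + 2) (t := 1) (by norm_cast; omega)
      have hdiv : 1 - 1 / ((k + 2 : ℕ) : ℝ) = ((k : ℝ) + 1) / (k + 2) := by
        push_cast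
        field_simp
        ring
      rwa [hdiv, div_pow, div_le_iff₀ (by positivity), Real.exp_neg,
        ← div_eq_inv_mul, le_div_iff₀' (Real.exp_pos 1)] at hexp
    calc Real.exp (k + 1 : ℕ) * ((k + 1 + 1).factorial : ℝ)
        = Real.exp 1 * (k + 2) * (Real.exp k * (k + 1).factorial) := by
          rw [Nat.factorial_succ (k + 1), Nat.cast_add_one, Real.exp_add]
          push_cast
          ring
      _ ≤ Real.exp 1 * (k + 2) * ((k : ℝ) + 1) ^ (k + 2) := by gcongr
      _ = (k + 2) * (Real.exp 1 * ((k : ℝ) + 1) ^ (k + 2)) := by ring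
      _ ≤ (k + 2) * ((k : ℝ) + 2) ^ (k + 2) := by gcongr
      _ = ((k + 1 : ℕ) + 1 : ℝ) ^ (k + 1 + 2) := by
          push_cast
          ring

lemma pow_succ_le_two_mul_choose {n k : ℕ} (hkn : 2 * ((k + 1) * k) ≤ n) (hn : n ≠ 0) :
    (n : ℝ) ^ (k + 1) ≤ 2 * ((k + 1) * n.choose (k + 1)) * k.factorial := by
  have hle : k ≤ n := by nlinarith
  have hn0 : (0 : ℝ) < n := Nat.cast_pos.2 (Nat.pos_of_ne_zero hn)
  have hbernoulli : 1 / 2 ≤ (1 - k / n : ℝ) ^ (k + 1) := by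
    have hsmall : ((k : ℝ) + 1) * (k / n) ≤ 1 / 2 := by
      rw [← mul_div_assoc, div_le_iff₀ hn0]
      have hcast : (2 : ℝ) * ((k + 1) * k) ≤ n := by exact_mod_cast hkn
      linarith
    have hdiv : (k : ℝ) / n ≤ 1 := (div_le_one hn0).2 (Nat.cast_le.2 hle)
    have h := one_add_mul_le_pow (a := -(k / n : ℝ)) (by linarith) (k + 1)
    push_cast [← sub_eq_add_neg] at h
    linarith
  have hdesc : ((n : ℝ) - k) ^ (k + 1) ≤ (k + 1) * n.choose (k + 1) * k.factorial := by
    have h := Nat.pow_sub_le_descFactorial n (k + 1)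
    rw [Nat.descFactorial_eq_factorial_mul_choose, Nat.factorial_succ, Nat.add_sub_add_right] at h
    rw [← Nat.cast_sub hle]
    exact_mod_cast h.trans_eq (by ring)
  calc (n : ℝ) ^ (k + 1) = 2 * (n ^ (k + 1) * (1 / 2)) := by ring
    _ ≤ 2 * (n ^ (k + 1) * (1 - k / n : ℝ) ^ (k + 1)) := by gcongr
    _ = 2 * ((n : ℝ) - k) ^ (k + 1) := by
        rw [← mul_pow, mul_sub, mul_one, mul_div_cancel₀ _ hn0.ne']
    _ ≤ 2 * ((k + 1) * n.choose (k + 1) * k.factorial) := by gcongr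
    _ = _ := by ring

lemma choose_mul_choose_le_mul_pow {n k l : ℕ} (hl : l ≤ k) :
    k.choose l * (n - k).choose (k - l) ≤ (k * n) ^ (k - l) := by
  rw [← Nat.choose_symm hl, mul_pow]
  exact Nat.mul_le_mul (Nat.choose_le_pow _ _)
    ((Nat.choose_le_pow _ _).trans (Nat.pow_le_pow_left (Nat.sub_le _ _) _))

section Powers

variable {q : ℝ} (h0 : 0 ≤ q) (h1 : q ≤ 1)

include h0 h1

lemma pow_le_sqrt_pow {j k : ℕ} (h : k ≤ 2 * j) : q ^ j ≤ √q ^ k := by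
  calc q ^ j = √q ^ (2 * j) := by rw [pow_mul, Real.sq_sqrt h0]
    _ ≤ √q ^ k := pow_le_pow_of_le_one (Real.sqrt_nonneg q) (Real.sqrt_le_one.2 h1) h

lemma sqrt_pow_pow_le_pow_choose_two_of_two_mul_le {k l : ℕ} (hl : 2 * l ≤ k + 2) :
    (√q ^ k) ^ l ≤ (q ^ 2) ^ l.choose 2 := by
  rcases l with _ | l
  · simp
  rw [← pow_pow_succ_eq]
  refine pow_le_pow_left₀ (by positivity) ?_ _
  calc √q ^ k ≤ √q ^ (2 * l) :=
        pow_le_pow_of_le_one (Real.sqrt_nonneg q) (Real.sqrt_le_one.2 h1) (by omega)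
    _ = q ^ l := by rw [pow_mul, Real.sq_sqrt h0]

lemma pow_choose_two_le_pow_choose_two_mul {k l : ℕ} (hl : l ≤ k) (hk : k < 2 * l) :
    (q ^ 2) ^ (k + 1).choose 2 ≤ (q ^ 2) ^ l.choose 2 * (q ^ k * √q ^ k) ^ (k + 1 - l) := by
  obtain ⟨j, rfl⟩ := Nat.exists_eq_add_of_le hl
  obtain ⟨i, rfl⟩ := Nat.exists_eq_add_of_le' (show 1 ≤ l by omega)
  rw [show i + 1 + j + 1 - (i + 1) = j + 1 by omega]
  calc (q ^ 2) ^ (i + 1 + j + 1).choose 2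
      = (q ^ 2) ^ (i + 1).choose 2 * (q ^ (i + 1 + j) * q ^ (i + 1)) ^ (j + 1) := by
        rw [← pow_pow_succ_eq, ← pow_pow_succ_eq]
        ring
    _ ≤ _ := by
        gcongr
        exact pow_le_sqrt_pow h0 h1 hk.le

end Powers

/-- The regime of orders `n` and sizes `k` in which, at the critical density, the number of clique
witnesses of size `k` has expectation bounded below. Here `q` is the probability of a non-edge and
`n * q ^ k` is roughly the expected number of vertices adjacent to no vertex of a fixed `k`-set. -/
structure DenseRegime (q : ℝ) (n k : ℕ) : Prop where
  pos : 0 < q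
  lt_one : q < 1
  one_le : 1 ≤ k
  le_mean : (k : ℝ) ≤ n * q ^ k
  mean_le : n * q ^ k ≤ k + 1
  cube_le : ((k : ℝ) + 1) ^ 3 * √q ^ k ≤ 1 / 4

/-- Up to a constant factor, the ratio between the probability that two `(k + 1)`-cliques with
distinguished vertices are both witnesses and the square of the probability that one of them is.
The cliques share `l` vertices, of which `i` are distinguished in neither of them. -/
noncomputable def overlapWeight (q : ℝ) (n k l i : ℕ) : ℝ :=
  ((q ^ 2) ^ l.choose 2)⁻¹ * Real.exp (n * q ^ k * q ^ (k - i))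

lemma overlapWeight_nonneg (q : ℝ) (n k l i : ℕ) : 0 ≤ overlapWeight q n k l i := by
  rw [overlapWeight]
  positivity

namespace DenseRegime

variable {q : ℝ} {n k : ℕ} (h : DenseRegime q n k)

include h

lemma sq_mul_le : 4 * ((k : ℝ) + 1) ^ 2 * √q ^ k ≤ 1 := by
  have hle : ((k : ℝ) + 1) ^ 2 * √q ^ k ≤ ((k : ℝ) + 1) ^ 3 * √q ^ k := by
    gcongr
    · exact le_add_of_nonneg_left k.cast_nonneg
    · norm_num
  linarith [h.cube_le]

lemma mul_pow_le : ((k : ℝ) + 1) * q ^ k ≤ 1 / 4 := by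
  have hq := h.pos
  have hpow : q ^ k ≤ √q ^ k := pow_le_sqrt_pow hq.le h.lt_one.le (by omega)
  have hk : (1 : ℝ) ≤ k + 1 := le_add_of_nonneg_left k.cast_nonneg
  calc ((k : ℝ) + 1) * q ^ k ≤ ((k : ℝ) + 1) ^ 2 * √q ^ k := by
        gcongr
        exact le_self_pow₀ hk two_ne_zero
    _ ≤ 1 / 4 := by linarith [h.sq_mul_le]

lemma four_mul_sq_le_mul_sqrt_pow : 4 * ((k : ℝ) + 1) ^ 2 ≤ n * √q ^ k := by
  have hs : 0 < √q ^ k := pow_pos (Real.sqrt_pos.2 h.pos) k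
  have hk : (1 : ℝ) ≤ k := Nat.one_le_cast.2 h.one_le
  refine le_of_mul_le_mul_right ?_ hs
  calc 4 * ((k : ℝ) + 1) ^ 2 * √q ^ k ≤ k := h.sq_mul_le.trans hk
    _ ≤ n * q ^ k := h.le_mean
    _ = n * √q ^ k * √q ^ k := by rw [mul_assoc, ← mul_pow, Real.mul_self_sqrt h.pos.le]

lemma four_mul_sq_le : 4 * (k + 1) ^ 2 ≤ n := by
  have hle : (n : ℝ) * √q ^ k ≤ n := mul_le_of_le_one_right n.cast_nonneg
    (pow_le_one₀ (Real.sqrt_nonneg q) (Real.sqrt_le_one.2 h.lt_one.le))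
  exact_mod_cast h.four_mul_sq_le_mul_sqrt_pow.trans hle

lemma inv_mul_exp_le : ((q ^ 2) ^ (k + 1).choose 2)⁻¹ * Real.exp (n * q ^ k) ≤
    2 * Real.exp 2 * ((k + 1) * n.choose (k + 1)) := by
  have hq := h.pos
  have hn := h.four_mul_sq_le
  have hpow := pow_succ_le_two_mul_choose (n := n) (k := k) (by nlinarith)
    (Nat.ne_of_gt ((by positivity : 0 < 4 * (k + 1) ^ 2).trans_le hn))
  have hfactorial : Real.exp (n * q ^ k) * k.factorial ≤ Real.exp 2 * (n * q ^ k) ^ (k + 1) := by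
    obtain ⟨j, rfl⟩ := Nat.exists_eq_add_of_le' h.one_le
    calc Real.exp (n * q ^ (j + 1)) * (j + 1).factorial
        ≤ Real.exp (2 + j) * (j + 1).factorial := by
          gcongr
          exact h.mean_le.trans_eq (by push_cast; ring)
      _ = Real.exp 2 * (Real.exp j * (j + 1).factorial) := by rw [Real.exp_add, mul_assoc]
      _ ≤ Real.exp 2 * ((j : ℝ) + 1) ^ (j + 2) := by
          gcongr
          exact exp_mul_factorial_succ_le j
      _ ≤ Real.exp 2 * (n * q ^ (j + 1)) ^ (j + 1 + 1) := by
          gcongr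
          exact_mod_cast h.le_mean
  rw [inv_mul_le_iff₀ (by positivity), ← pow_pow_succ_eq]
  refine le_of_mul_le_mul_right ?_ (Nat.cast_pos.2 k.factorial_pos)
  calc Real.exp (n * q ^ k) * k.factorial ≤ Real.exp 2 * (n * q ^ k) ^ (k + 1) := hfactorial
    _ = Real.exp 2 * (q ^ k) ^ (k + 1) * n ^ (k + 1) := by
        rw [mul_pow]
        ring
    _ ≤ Real.exp 2 * (q ^ k) ^ (k + 1) * (2 * ((k + 1) * n.choose (k + 1)) * k.factorial) := by
        gcongr
    _ = _ := by ring

lemma choose_mul_overlapWeight_le_of_two_mul_le {l : ℕ} (hl : 2 * l ≤ k) :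
    ((k + 1).choose l * (n - (k + 1)).choose (k + 1 - l) : ℕ) * overlapWeight q n k l l ≤
      2 * Real.exp 2 * n.choose (k + 1) * (1 / 2) ^ l := by
  have hq := h.pos
  have hn := h.four_mul_sq_le
  have hkn : k + 1 < n := by nlinarith
  have hkn' : (0 : ℝ) < n - (k + 1 : ℕ) := sub_pos.2 (Nat.cast_lt.2 hkn)
  have hexp : Real.exp (n * q ^ k * q ^ (k - l)) ≤ 2 * Real.exp 2 := by
    have hle : n * q ^ k * q ^ (k - l) ≤ 2 := by
      calc n * q ^ k * q ^ (k - l) ≤ (k + 1) * √q ^ k := by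
            gcongr
            · exact h.mean_le
            · exact pow_le_sqrt_pow hq.le h.lt_one.le (by omega)
        _ ≤ 2 := by nlinarith [h.sq_mul_le]
    linarith [Real.exp_le_exp.2 hle, Real.exp_pos 2]
  have hratio : ((k + 1 : ℕ) : ℝ) ^ 2 / (n - (k + 1 : ℕ)) * (√q ^ k)⁻¹ ≤ 1 / 2 := by
    rw [← div_eq_mul_inv, div_div, div_le_iff₀ (by positivity)]
    have hsmall : ((k : ℝ) + 1) * √q ^ k ≤ 1 := by nlinarith [h.sq_mul_le]
    push_cast
    nlinarith [h.four_mul_sq_le_mul_sqrt_pow]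
  calc _ ≤ n.choose (k + 1) * (((k + 1 : ℕ) : ℝ) ^ 2 / (n - (k + 1 : ℕ))) ^ l *
        (((√q ^ k) ^ l)⁻¹ * (2 * Real.exp 2)) := by
        rw [overlapWeight]
        gcongr
        · exact choose_mul_choose_le (by omega) hkn
        · exact sqrt_pow_pow_le_pow_choose_two_of_two_mul_le hq.le h.lt_one.le (by omega)
    _ = 2 * Real.exp 2 * n.choose (k + 1) *
        (((k + 1 : ℕ) : ℝ) ^ 2 / (n - (k + 1 : ℕ)) * (√q ^ k)⁻¹) ^ l := by
        rw [mul_pow, inv_pow]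
        ring
    _ ≤ _ := by gcongr

lemma overlapWeight_le_of_lt_two_mul {l : ℕ} (hlk : l ≤ k) (hl : k < 2 * l) :
    overlapWeight q n k l l ≤ 2 * Real.exp 2 * ((k + 1) * n.choose (k + 1)) *
      (q ^ k * √q ^ k) ^ (k + 1 - l) := by
  have hq := h.pos
  calc overlapWeight q n k l l
      ≤ (((q ^ 2) ^ (k + 1).choose 2)⁻¹ * (q ^ k * √q ^ k) ^ (k + 1 - l)) *
          Real.exp (n * q ^ k) := by
        rw [overlapWeight]
        refine mul_le_mul ?_ (Real.exp_le_exp.2 ?_) (Real.exp_pos _).le (by positivity)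
        · rw [inv_mul_eq_div, le_div_iff₀ (by positivity), inv_mul_le_iff₀ (by positivity)]
          exact pow_choose_two_le_pow_choose_two_mul hq.le h.lt_one.le hlk hl
        · exact mul_le_of_le_one_right (by positivity) (pow_le_one₀ hq.le h.lt_one.le)
    _ = ((q ^ 2) ^ (k + 1).choose 2)⁻¹ * Real.exp (n * q ^ k) *
          (q ^ k * √q ^ k) ^ (k + 1 - l) := by ring
    _ ≤ _ := mul_le_mul_of_nonneg_right h.inv_mul_exp_le (by positivity)

lemma choose_mul_overlapWeight_le_of_lt_two_mul {l : ℕ} (hlk : l ≤ k) (hl : k < 2 * l) :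
    ((k + 1).choose l * (n - (k + 1)).choose (k + 1 - l) : ℕ) * overlapWeight q n k l l ≤
      2 * Real.exp 2 * n.choose (k + 1) * (1 / 2) ^ (k + 1 - l) := by
  have hq := h.pos
  have hk : (1 : ℝ) ≤ k + 1 := le_add_of_nonneg_left k.cast_nonneg
  have hratio : ((k : ℝ) + 1) ^ 2 * n * (q ^ k * √q ^ k) ≤ 1 / 2 := by
    calc ((k : ℝ) + 1) ^ 2 * n * (q ^ k * √q ^ k)
        = ((k : ℝ) + 1) ^ 2 * (n * q ^ k) * √q ^ k := by ring
      _ ≤ ((k : ℝ) + 1) ^ 2 * (k + 1) * √q ^ k := by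
          gcongr
          exact h.mean_le
      _ ≤ 1 / 2 := by linarith [h.cube_le]
  have hchoose : (((k + 1).choose l * (n - (k + 1)).choose (k + 1 - l) : ℕ) : ℝ) ≤
      (((k : ℝ) + 1) * n) ^ (k + 1 - l) := by
    exact_mod_cast choose_mul_choose_le_mul_pow (n := n) (hlk.trans k.le_succ)
  calc _ ≤ (((k : ℝ) + 1) * n) ^ (k + 1 - l) * (2 * Real.exp 2 *
        (((k : ℝ) + 1) ^ (k + 1 - l) * n.choose (k + 1)) * (q ^ k * √q ^ k) ^ (k + 1 - l)) := by
        gcongr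
        · exact overlapWeight_nonneg ..
        · refine (h.overlapWeight_le_of_lt_two_mul hlk hl).trans ?_
          gcongr
          exact le_self_pow₀ hk (by omega)
    _ = 2 * Real.exp 2 * n.choose (k + 1) *
        (((k : ℝ) + 1) ^ 2 * n * (q ^ k * √q ^ k)) ^ (k + 1 - l) := by
        generalize k + 1 - l = j
        generalize (k : ℝ) + 1 = a
        ring
    _ ≤ _ := by gcongr

lemma sum_choose_mul_overlapWeight_le :
    ∑ l ∈ Finset.range (k + 1),
      ((k + 1).choose l * (n - (k + 1)).choose (k + 1 - l) : ℕ) * overlapWeight q n k l l ≤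
      8 * Real.exp 2 * n.choose (k + 1) := by
  have hgeom : ∀ N, ∑ l ∈ Finset.range N, (1 / 2 : ℝ) ^ l ≤ 2 := sum_geometric_two_le
  have hreflect : ∑ l ∈ Finset.range (k + 1), (1 / 2 : ℝ) ^ (k + 1 - l) ≤ 2 := by
    refine le_trans ?_ (hgeom (k + 2))
    rw [← Finset.sum_range_reflect _ (k + 2), Finset.sum_range_succ _ (k + 1)]
    exact le_add_of_nonneg_right (by positivity)
  calc _ ≤ ∑ l ∈ Finset.range (k + 1), 2 * Real.exp 2 * n.choose (k + 1) *
        ((1 / 2 : ℝ) ^ l + (1 / 2 : ℝ) ^ (k + 1 - l)) := by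
        refine Finset.sum_le_sum fun l hl => ?_
        rcases le_or_gt (2 * l) k with hlk | hlk
        · refine (h.choose_mul_overlapWeight_le_of_two_mul_le hlk).trans ?_
          gcongr
          exact le_add_of_nonneg_right (by positivity)
        · refine (h.choose_mul_overlapWeight_le_of_lt_two_mul
            (Finset.mem_range_succ_iff.1 hl) hlk).trans ?_
          gcongr
          exact le_add_of_nonneg_left (by positivity)
    _ = 2 * Real.exp 2 * n.choose (k + 1) * (∑ l ∈ Finset.range (k + 1), (1 / 2 : ℝ) ^ l +
        ∑ l ∈ Finset.range (k + 1), (1 / 2 : ℝ) ^ (k + 1 - l)) := by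
        rw [← Finset.mul_sum, Finset.sum_add_distrib]
    _ ≤ 2 * Real.exp 2 * n.choose (k + 1) * (2 + 2) := by
        gcongr
        exact hgeom _
    _ = _ := by ring

end DenseRegime

end CriticalDense

section CriticalSecondMoment

lemma mul_exp_mul_le {q : ℝ} (hq : q < 1) (y : ℝ) :
    y * Real.exp (y * q) ≤ (1 - q)⁻¹ * Real.exp y := by
  have hq1 : 0 < 1 - q := sub_pos.2 hq
  rw [inv_mul_eq_div, le_div_iff₀ hq1]
  calc y * Real.exp (y * q) * (1 - q) = (1 - q) * y * Real.exp (y * q) := by ring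
    _ ≤ Real.exp ((1 - q) * y) * Real.exp (y * q) := by
        gcongr
        linarith [Real.add_one_le_exp ((1 - q) * y)]
    _ = Real.exp y := by
        rw [← Real.exp_add]
        ring_nf

lemma exp_neg_le_one_sub {u : ℝ} (hu : u ≤ 1 / 2) : Real.exp (-(u + 2 * u ^ 2)) ≤ 1 - u := by
  have hexp := Real.add_one_le_exp (u + 2 * u ^ 2)
  rw [Real.exp_neg]
  refine inv_le_of_inv_le₀ (by linarith) (le_trans ?_ hexp)
  rw [inv_le_iff_one_le_mul₀ (by linarith)]
  nlinarith [sq_nonneg u]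

lemma overlapWeight_le_overlapWeight {q : ℝ} (h0 : 0 ≤ q) (h1 : q ≤ 1) {n k l i j : ℕ}
    (hij : i ≤ j) : overlapWeight q n k l i ≤ overlapWeight q n k l j := by
  have hpow : q ^ (k - i) ≤ q ^ (k - j) := pow_le_pow_of_le_one h0 h1 (by omega)
  rw [overlapWeight, overlapWeight]
  gcongr

section Erase

variable {V : Type*} [DecidableEq V] {S Y : Finset V} {x : V} {k : ℕ}

lemma card_erase_of_mem_powersetCard (hY : Y ∈ S.powersetCard (k + 1)) (hx : x ∈ Y) :
    (Y.erase x).card = k := by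
  rw [Finset.card_erase_of_mem hx, (Finset.mem_powersetCard.1 hY).2, Nat.add_sub_cancel]

lemma sum_card_erase_inter_erase (hY : Y.card = k + 1) (hx : x ∈ Y) (f : ℕ → ℝ) :
    ∑ z ∈ Y, f (Y.erase x ∩ Y.erase z).card = f k + k * f (k - 1) := by
  have hYx : (Y.erase x).card = k := by rw [Finset.card_erase_of_mem hx, hY, Nat.add_sub_cancel]
  have hcard : ∀ z ∈ Y.erase x, (Y.erase x ∩ Y.erase z).card = k - 1 := fun z hz => by
    rw [Finset.inter_erase, Finset.inter_eq_left.2 (Finset.erase_subset x Y),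
      Finset.card_erase_of_mem hz, hYx]
  rw [← Finset.add_sum_erase _ _ hx, Finset.inter_self, hYx,
    Finset.sum_congr rfl fun z hz => congrArg f (hcard z hz), Finset.sum_const, hYx, nsmul_eq_mul]

omit [DecidableEq V] in
lemma card_sigma_powersetCard (S : Finset V) (k : ℕ) :
    ((S.powersetCard k).sigma fun Y => Y).card = S.card.choose k * k := by
  rw [Finset.card_sigma, Finset.sum_congr rfl fun Y hY => (Finset.mem_powersetCard.1 hY).2,
    Finset.sum_const, Finset.card_powersetCard, smul_eq_mul]

lemma witnessEvent_erase (hx : x ∈ Y) :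
    witnessEvent true x (Y.erase x) = cliqueEvent Y ∩ noUniformEvent false (Y.erase x) Y := by
  rw [witnessEvent, rootedEvent_true (Finset.notMem_erase x Y), Finset.insert_erase hx,
    Bool.not_true]

lemma real_witnessEvent_erase [Fintype V] (p : I) (hY : Y ∈ S.powersetCard (k + 1)) (hx : x ∈ Y) :
    G(V, p).real (witnessEvent true x (Y.erase x)) =
      (p : ℝ) ^ (k + 1).choose 2 * (1 - (1 - p : ℝ) ^ k) ^ (Fintype.card V - (k + 1)) := by
  rw [real_witnessEvent p true (Finset.notMem_erase _ _), card_erase_of_mem_powersetCard hY hx,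
    edgeProb, cond_true, edgeProb, Bool.not_true, cond_false, ← pow_add,
    Nat.choose_succ_succ' k 1, Nat.choose_one_right, add_comm (k.choose 2)]

lemma iUnion_witnessEvent_erase_subset [Finite V] (hk : 1 ≤ k) :
    ⋃ c ∈ (S.powersetCard (k + 1)).sigma fun Y => Y, witnessEvent true c.2 (c.1.erase c.2) ⊆
      {G | ¬ PhiC3 G} := by
  intro G hG
  obtain ⟨c, hc, hG⟩ := Set.mem_iUnion₂.1 hG
  obtain ⟨hY, hx⟩ := Finset.mem_sigma.1 hc
  refine not_phiC3_iff.2 ⟨c.2, c.1.erase c.2, Finset.card_pos.1 ?_, Finset.notMem_erase _ _, hG⟩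
  rw [card_erase_of_mem_powersetCard hY hx]
  exact hk

end Erase

/-- The constant in the second moment bound for clique witnesses in a `DenseRegime`. -/
noncomputable def momentBound (q : ℝ) : ℝ :=
  2 * Real.exp 2 * (1 + (1 - q)⁻¹) + 8 * Real.exp 2

lemma momentBound_pos {q : ℝ} (hq : q < 1) : 0 < momentBound q := by
  have := sub_pos.2 hq
  rw [momentBound]
  positivity

namespace DenseRegime

section Estimates

variable {q : ℝ} {n k : ℕ} (h : DenseRegime q n k)

include h

lemma exp_neg_sub_half_le :
    Real.exp (-(n * q ^ k) - 1 / 2) ≤ (1 - q ^ k) ^ (n - (k + 1)) := by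
  have hu := h.mul_pow_le
  have hq : 0 < q ^ k := pow_pos h.pos k
  have : (0 : ℝ) ≤ k := k.cast_nonneg
  have hy := h.mean_le
  have hu2 : q ^ k ≤ 1 / 2 := by nlinarith
  calc Real.exp (-(n * q ^ k) - 1 / 2) ≤ Real.exp (-(q ^ k + 2 * (q ^ k) ^ 2)) ^ n := by
        rw [← Real.exp_nat_mul, Real.exp_le_exp]
        nlinarith
    _ ≤ (1 - q ^ k) ^ n := by
        gcongr
        exact exp_neg_le_one_sub hu2
    _ ≤ _ := pow_le_pow_of_le_one (by linarith) (by linarith) (Nat.sub_le _ _)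

lemma pow_sub_le_exp {d : ℝ} (hd0 : 0 ≤ d) (hd1 : d ≤ 1) {s : ℕ}
    (hs : s ≤ 2 * (k + 1)) (hsn : s ≤ n) :
    (1 - q ^ k - q ^ k + q ^ k * d) ^ (n - s) ≤
      Real.exp (-(2 * (n * q ^ k)) + n * q ^ k * d + 1) := by
  have hu := h.mul_pow_le
  have hq : 0 < q ^ k := pow_pos h.pos k
  have : (0 : ℝ) ≤ k := k.cast_nonneg
  have hs' : (s : ℝ) ≤ 2 * (k + 1) := by exact_mod_cast hs
  set t := q ^ k * (2 - d) with ht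
  have ht0 : 0 ≤ t := mul_nonneg hq.le (by linarith)
  have ht2 : t ≤ 2 * q ^ k := by nlinarith
  have ht1 : 0 ≤ 1 - t := by nlinarith
  have hst : s * t ≤ 1 := by
    calc (s : ℝ) * t ≤ (2 * (k + 1)) * (2 * q ^ k) := by gcongr
      _ ≤ 1 := by linarith
  calc (1 - q ^ k - q ^ k + q ^ k * d) ^ (n - s) = (1 - t) ^ (n - s) := by
        rw [ht]
        ring
    _ ≤ Real.exp (-t) ^ (n - s) := pow_le_pow_left₀ ht1 (Real.one_sub_le_exp_neg t) _
    _ = Real.exp (-(2 * (n * q ^ k)) + n * q ^ k * d + s * t) := by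
        rw [← Real.exp_nat_mul, Nat.cast_sub hsn, ht]
        ring_nf
    _ ≤ _ := by gcongr

lemma pow_sub_le_sq_mul_exp {d : ℝ} (hd0 : 0 ≤ d) (hd1 : d ≤ 1) {s : ℕ}
    (hs : s ≤ 2 * (k + 1)) (hsn : s ≤ n) :
    (1 - q ^ k - q ^ k + q ^ k * d) ^ (n - s) ≤
      Real.exp 2 * ((1 - q ^ k) ^ (n - (k + 1))) ^ 2 * Real.exp (n * q ^ k * d) := by
  calc _ ≤ Real.exp (-(2 * (n * q ^ k)) + n * q ^ k * d + 1) := h.pow_sub_le_exp hd0 hd1 hs hsn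
    _ = Real.exp 2 * Real.exp (-(n * q ^ k) - 1 / 2) ^ 2 * Real.exp (n * q ^ k * d) := by
        rw [← Real.exp_nat_mul, ← Real.exp_add, ← Real.exp_add]
        ring_nf
    _ ≤ _ := by
        gcongr
        exact h.exp_neg_sub_half_le

lemma overlapWeight_add_mul_overlapWeight_le :
    overlapWeight q n k (k + 1) k + k * overlapWeight q n k (k + 1) (k - 1) ≤
      2 * Real.exp 2 * (1 + (1 - q)⁻¹) * ((k + 1) * n.choose (k + 1)) := by
  have hq := h.pos
  have hk : k - (k - 1) = 1 := Nat.sub_sub_self h.one_le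
  have hexp : k * Real.exp (n * q ^ k * q) ≤ (1 - q)⁻¹ * Real.exp (n * q ^ k) :=
    (mul_le_mul_of_nonneg_right h.le_mean (Real.exp_pos _).le).trans (mul_exp_mul_le h.lt_one _)
  have hq1 : 0 < 1 - q := sub_pos.2 h.lt_one
  rw [overlapWeight, overlapWeight, hk, Nat.sub_self, pow_zero, mul_one, pow_one]
  set P := (q ^ 2) ^ (k + 1).choose 2
  calc P⁻¹ * Real.exp (n * q ^ k) + k * (P⁻¹ * Real.exp (n * q ^ k * q))
      = P⁻¹ * (Real.exp (n * q ^ k) + k * Real.exp (n * q ^ k * q)) := by ring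
    _ ≤ P⁻¹ * (Real.exp (n * q ^ k) + (1 - q)⁻¹ * Real.exp (n * q ^ k)) := by gcongr
    _ = (1 + (1 - q)⁻¹) * (P⁻¹ * Real.exp (n * q ^ k)) := by ring
    _ ≤ (1 + (1 - q)⁻¹) * (2 * Real.exp 2 * ((k + 1) * n.choose (k + 1))) :=
        mul_le_mul_of_nonneg_left h.inv_mul_exp_le (by positivity)
    _ = _ := by ring

end Estimates

variable {V : Type*} [Fintype V] [DecidableEq V] {k : ℕ} {Y Z : Finset V} {x z : V}

section Overlap

variable {q : ℝ} (h : DenseRegime q (Fintype.card V) k)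

include h

lemma sum_erase_overlapWeight_le
    (hY : Y ∈ (Finset.univ : Finset V).powersetCard (k + 1)) (x : V) :
    ∑ Z ∈ ((Finset.univ : Finset V).powersetCard (k + 1)).erase Y, ∑ z ∈ Z,
      overlapWeight q (Fintype.card V) k (Y ∩ Z).card (Y.erase x ∩ Z.erase z).card ≤
      8 * Real.exp 2 * ((k + 1) * (Fintype.card V).choose (k + 1)) := by
  set F : ℕ → ℝ := fun l => overlapWeight q (Fintype.card V) k l l
  have hmono : ∀ Z ∈ ((Finset.univ : Finset V).powersetCard (k + 1)).erase Y,
      ∑ z ∈ Z, overlapWeight q (Fintype.card V) k (Y ∩ Z).card (Y.erase x ∩ Z.erase z).card ≤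
        (k + 1) * F (Y ∩ Z).card := by
    intro Z hZ
    have hZk := (Finset.mem_powersetCard.1 (Finset.mem_of_mem_erase hZ)).2
    refine (Finset.sum_le_card_nsmul _ _ _ fun z _ => overlapWeight_le_overlapWeight h.pos.le
      h.lt_one.le (Finset.card_le_card (Finset.inter_subset_inter (Finset.erase_subset x Y)
        (Finset.erase_subset z Z)))).trans_eq ?_
    rw [hZk, nsmul_eq_mul, Nat.cast_add_one]
  calc _ ≤ ∑ Z ∈ ((Finset.univ : Finset V).powersetCard (k + 1)).erase Y,
        ((k : ℝ) + 1) * F (Y ∩ Z).card := Finset.sum_le_sum hmono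
    _ ≤ ((k : ℝ) + 1) * (8 * Real.exp 2 * (Fintype.card V).choose (k + 1)) := by
        rw [← Finset.mul_sum]
        gcongr
        refine (sum_erase_card_inter_le hY fun l => overlapWeight_nonneg _ _ _ l l).trans ?_
        exact h.sum_choose_mul_overlapWeight_le
    _ = _ := by ring

lemma sum_overlapWeight_le (hY : Y ∈ (Finset.univ : Finset V).powersetCard (k + 1)) (hx : x ∈ Y) :
    ∑ Z ∈ (Finset.univ : Finset V).powersetCard (k + 1), ∑ z ∈ Z,
      overlapWeight q (Fintype.card V) k (Y ∩ Z).card (Y.erase x ∩ Z.erase z).card ≤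
      momentBound q * ((k + 1) * (Fintype.card V).choose (k + 1)) := by
  have hYk := (Finset.mem_powersetCard.1 hY).2
  rw [← Finset.add_sum_erase _ _ hY, momentBound, add_mul, Finset.inter_self, hYk,
    sum_card_erase_inter_erase hYk hx]
  exact add_le_add h.overlapWeight_add_mul_overlapWeight_le (h.sum_erase_overlapWeight_le hY x)

end Overlap

variable {p : I} (h : DenseRegime (1 - p) (Fintype.card V) k) (hp : (p : ℝ) = (1 - p) ^ 2)

include h hp

lemma real_witnessEvent_erase_inter_le (hY : Y ∈ (Finset.univ : Finset V).powersetCard (k + 1))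
    (hx : x ∈ Y) (hZ : Z ∈ (Finset.univ : Finset V).powersetCard (k + 1)) (hz : z ∈ Z) :
    G(V, p).real (witnessEvent true x (Y.erase x) ∩ witnessEvent true z (Z.erase z)) ≤
      Real.exp 2 * ((p : ℝ) ^ (k + 1).choose 2 *
        (1 - (1 - p : ℝ) ^ k) ^ (Fintype.card V - (k + 1))) ^ 2 *
        overlapWeight (1 - p) (Fintype.card V) k (Y ∩ Z).card (Y.erase x ∩ Z.erase z).card := by
  have hYk := (Finset.mem_powersetCard.1 hY).2
  have hZk := (Finset.mem_powersetCard.1 hZ).2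
  have hX := card_erase_of_mem_powersetCard hY hx
  have hW := card_erase_of_mem_powersetCard hZ hz
  have hunion : (Y.erase x ∪ Z.erase z).card = k + (k - (Y.erase x ∩ Z.erase z).card) := by
    have hadd := Finset.card_union_add_card_inter (Y.erase x) (Z.erase z)
    have hle := Finset.card_le_card (Finset.inter_subset_left (s₁ := Y.erase x) (s₂ := Z.erase z))
    omega
  have hp0 : 0 < (p : ℝ) := hp ▸ pow_pos h.pos 2
  have hno := real_inter_noUniformEvent_inter_le p false (Finset.erase_subset x Y)
    (Finset.erase_subset z Z) (measurableSet_cliqueEvent_inter Y Z)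
  rw [hX, hW, hunion, edgeProb, cond_false, pow_add] at hno
  rw [witnessEvent_erase hx, witnessEvent_erase hz, Set.inter_inter_inter_comm]
  calc _ ≤ _ := hno
    _ ≤ G(V, p).real (cliqueEvent Y ∩ cliqueEvent Z) * _ :=
        mul_le_mul_of_nonneg_left (h.pow_sub_le_sq_mul_exp (pow_nonneg h.pos.le _)
          (pow_le_one₀ h.pos.le h.lt_one.le) ((Finset.card_union_le Y Z).trans (by omega))
          (Finset.card_le_univ _)) measureReal_nonneg
    _ = _ := by
        rw [eq_div_of_mul_eq (by positivity) (real_cliqueEvent_inter p Y Z), hYk, hZk,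
          overlapWeight, ← hp]
        ring

omit [DecidableEq V] in
lemma inv_le_real_not_phiC3 :
    (Real.exp 2 * momentBound (1 - p))⁻¹ ≤ G(V, p).real {G | ¬ PhiC3 G} := by
  classical
  have hp0 : 0 < (p : ℝ) := hp ▸ pow_pos h.pos 2
  have hmoment : 0 < momentBound (1 - p) := momentBound_pos h.lt_one
  set S := (Finset.univ : Finset V).powersetCard (k + 1)
  set a := (p : ℝ) ^ (k + 1).choose 2 * (1 - (1 - p : ℝ) ^ k) ^ (Fintype.card V - (k + 1))
  have ha : 0 < a := mul_pos (pow_pos hp0 _) ((Real.exp_pos _).trans_le h.exp_neg_sub_half_le)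
  have hcard : ((S.sigma fun Y => Y).card : ℝ) = (k + 1) * (Fintype.card V).choose (k + 1) := by
    rw [card_sigma_powersetCard, Finset.card_univ]
    push_cast
    ring
  have hchoose : 0 < (Fintype.card V).choose (k + 1) :=
    Nat.choose_pos (by nlinarith [h.four_mul_sq_le])
  have hne : (S.sigma fun Y => Y).Nonempty := by
    rw [← Finset.card_pos, ← Nat.cast_pos (α := ℝ), hcard]
    positivity
  have hone := one_le_mul_measureReal_biUnion (μ := G(V, p)) (a := a)
    (K := Real.exp 2 * momentBound (1 - p)) (s := S.sigma fun Y => Y)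
    (A := fun c => witnessEvent true c.2 (c.1.erase c.2))
    (fun _ _ => .of_discrete) hne ha
    (fun c hc => real_witnessEvent_erase p (Finset.mem_sigma.1 hc).1 (Finset.mem_sigma.1 hc).2)
    (fun c hc => ?_)
  · refine ((inv_le_iff_one_le_mul₀' (by positivity)).2 hone).trans (measureReal_mono ?_)
    exact iUnion_witnessEvent_erase_subset h.one_le
  · obtain ⟨hY, hx⟩ := Finset.mem_sigma.1 hc
    calc _ ≤ ∑ Z ∈ S, ∑ z ∈ Z, Real.exp 2 * a ^ 2 *
          overlapWeight (1 - p) (Fintype.card V) k (c.1 ∩ Z).card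
            (c.1.erase c.2 ∩ Z.erase z).card := by
          rw [Finset.sum_sigma]
          exact Finset.sum_le_sum fun Z hZ => Finset.sum_le_sum fun z hz =>
            h.real_witnessEvent_erase_inter_le hp hY hx hZ hz
      _ ≤ Real.exp 2 * a ^ 2 *
          (momentBound (1 - p) * ((k + 1) * (Fintype.card V).choose (k + 1))) := by
          simp_rw [← Finset.mul_sum]
          exact mul_le_mul_of_nonneg_left (h.sum_overlapWeight_le hY hx) (by positivity)
      _ = _ := by
          rw [hcard]
          ring

end DenseRegime

end CriticalSecondMoment

section CriticalNonconvergence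

/-- Orders along which the expected number of clique witnesses at the critical density is bounded
below. -/
noncomputable def denseOrder (q : ℝ) (m : ℕ) : ℕ := ⌈m / q ^ m⌉₊

variable {q : ℝ} (h0 : 0 < q) (h1 : q < 1)

include h0 h1

lemma eventually_denseRegime : ∀ᶠ m in atTop, DenseRegime q (denseOrder q m) m := by
  have hs0 : 0 < √q := Real.sqrt_pos.2 h0
  have hs1 : √q < 1 := (Real.sqrt_lt' one_pos).2 (by simpa using h1)
  have hcube : Tendsto (fun m : ℕ => ((m : ℝ) + 1) ^ 3 * √q ^ m) atTop (𝓝 0) := by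
    have hlim := ((tendsto_pow_const_mul_const_pow_of_lt_one 3 hs0.le hs1).comp
      (tendsto_add_atTop_nat 1)).mul_const (√q)⁻¹
    rw [zero_mul] at hlim
    refine hlim.congr fun m => ?_
    rw [Function.comp_apply, pow_succ √q, Nat.cast_add_one]
    field_simp
  filter_upwards [eventually_ge_atTop 1, hcube.eventually_le_const (by norm_num : (0 : ℝ) < 1 / 4)]
    with m hm hcube
  have hqm : 0 < q ^ m := by positivity
  refine ⟨h0, h1, hm, (div_le_iff₀ hqm).1 (Nat.le_ceil _), ?_, hcube⟩
  have hceil : (denseOrder q m : ℝ) < m / q ^ m + 1 := Nat.ceil_lt_add_one (by positivity)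
  calc (denseOrder q m : ℝ) * q ^ m ≤ (m / q ^ m + 1) * q ^ m := by gcongr
    _ = m + q ^ m := by rw [add_mul, div_mul_cancel₀ _ hqm.ne', one_mul]
    _ ≤ m + 1 := by linarith [pow_le_one₀ (n := m) h0.le h1.le]

lemma tendsto_denseOrder : Tendsto (denseOrder q) atTop atTop := by
  refine tendsto_atTop_mono (fun m => ?_) tendsto_id
  have hle : (m : ℝ) ≤ m / q ^ m :=
    le_div_self m.cast_nonneg (by positivity) (pow_le_one₀ h0.le h1.le)
  exact_mod_cast hle.trans (Nat.le_ceil _)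

omit h0 h1

theorem not_tendsto_prob_phiC3 {p : I} (hp0 : 0 < (p : ℝ)) (hp1 : (p : ℝ) < 1)
    (hp : (p : ℝ) = (1 - p) ^ 2) :
    ¬ ∃ L : ℝ, Tendsto (fun n => prob n p fun G => PhiC3 G) atTop (𝓝 L) := by
  rintro ⟨L, hL⟩
  have hq0 : (0 : ℝ) < 1 - p := sub_pos.2 hp1
  have hq1 : (1 - p : ℝ) < 1 := sub_lt_self 1 hp0
  have hL1 : L = 1 := tendsto_nhds_unique (hL.comp (tendsto_sparseOrder hq0 hq1))
    (tendsto_prob_phiC3_sparseOrder hp0 hp1 hp)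
  have hdense := (hL.comp (tendsto_denseOrder hq0 hq1)).const_sub 1
  have hnot : Tendsto (fun m => prob (denseOrder (1 - p) m) p fun G => ¬ PhiC3 G) atTop (𝓝 0) := by
    simpa only [hL1, sub_self, prob_not, Function.comp_def] using hdense
  have hpos : 0 < (Real.exp 2 * momentBound (1 - p))⁻¹ :=
    inv_pos.2 (mul_pos (Real.exp_pos 2) (momentBound_pos hq1))
  obtain ⟨m, hlt, hm⟩ := ((hnot.eventually_lt_const hpos).and
    (eventually_denseRegime hq0 hq1)).exists
  rw [← Fintype.card_fin (denseOrder (1 - p) m)] at hm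
  exact (hm.inv_le_real_not_phiC3 hp).not_gt hlt

end CriticalNonconvergence

section Complement

variable {V : Type*} {G : SimpleGraph V} {X : Set V}

lemma adj_compl_iff_not_adj {x y : V} (hx : x ∉ X) (hy : y ∈ X) : Gᶜ.Adj x y ↔ ¬ G.Adj x y := by
  rw [SimpleGraph.compl_adj, and_iff_right (ne_of_mem_of_not_mem hy hx).symm]

lemma phiC_compl : PhiC Gᶜ X ↔ PhiI G X :=
  exists_congr fun _ => and_congr_right fun hx => forall₂_congr fun _ hy => by
    rw [adj_compl_iff_not_adj hx hy, not_not]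

lemma maxCl_compl : MaxCl Gᶜ X ↔ MaxInd G X :=
  and_congr (SimpleGraph.isClique_compl G) <| not_congr <| exists_congr fun _ =>
    and_congr_right fun hx => forall₂_congr fun _ hy => adj_compl_iff_not_adj hx hy

lemma phiC1_compl : PhiC1 Gᶜ ↔ PhiI1 G := by
  simp only [PhiC1, PhiI1, phiC_compl, SimpleGraph.isClique_compl]

lemma phiC2_compl : PhiC2 Gᶜ ↔ PhiI2 G := by
  simp only [PhiC2, PhiI2, phiC_compl, maxCl_compl]

lemma phiC3_compl : PhiC3 Gᶜ ↔ PhiI3 G := by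
  simp only [PhiC3, PhiI3, phiC_compl, maxCl_compl, SimpleGraph.isClique_compl]

lemma prob_compl (n : ℕ) (p : I) (Q : SimpleGraph (Fin n) → Prop) :
    prob n p (fun G => Q Gᶜ) = prob n (σ p) Q := by
  rw [prob, prob, ← map_compl_binomialRandom, map_measureReal_apply .of_discrete .of_discrete]
  rfl

end Complement

section Threshold

variable {x : ℝ}

lemma one_sub_sq_sub_eq_mul (x : ℝ) :
    (1 - x) ^ 2 - x = ((3 - √5) / 2 - x) * ((3 + √5) / 2 - x) := by
  linear_combination (Real.sq_sqrt (show (0 : ℝ) ≤ 5 by norm_num)) / 4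

lemma conjugate_threshold_sub_pos (hx : x < 1) : 0 < (3 + √5) / 2 - x := by
  linarith [Real.sqrt_nonneg 5]

lemma lt_threshold_iff (hx : x < 1) : x < (3 - √5) / 2 ↔ x < (1 - x) ^ 2 := by
  rw [← sub_pos, ← sub_pos (a := (1 - x) ^ 2), one_sub_sq_sub_eq_mul,
    mul_pos_iff_of_pos_right (conjugate_threshold_sub_pos hx)]

lemma eq_threshold_iff (hx : x < 1) : x = (3 - √5) / 2 ↔ x = (1 - x) ^ 2 := by
  rw [eq_comm, eq_comm (b := (1 - x) ^ 2), ← sub_eq_zero, ← sub_eq_zero (a := (1 - x) ^ 2),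
    one_sub_sq_sub_eq_mul, mul_eq_zero_iff_right (conjugate_threshold_sub_pos hx).ne']

lemma threshold_lt_iff (hx : x < 1) : (3 - √5) / 2 < x ↔ (1 - x) ^ 2 < x := by
  rw [← not_le, le_iff_lt_or_eq, lt_threshold_iff hx, eq_threshold_iff hx,
    ← le_iff_lt_or_eq, not_le]

end Threshold

end CliqueSentences

open CliqueSentences Filter Topology in
theorem lemma1 (p : unitInterval) (hp0 : 0 < (p : ℝ)) (hp1 : (p : ℝ) < 1) :
    ((3 - √5) / 2 < (p : ℝ) →
      Tendsto (fun n : ℕ => prob n p (fun G => ¬ PhiC1 G ∧ ¬ PhiC2 G ∧ ¬ PhiC3 G)) atTop (𝓝 1)) ∧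
    ((p : ℝ) < (3 - √5) / 2 →
      Tendsto (fun n : ℕ => prob n p (fun G => PhiC1 G)) atTop (𝓝 1)) ∧
    ((p : ℝ) = (3 - √5) / 2 →
      ¬ ∃ L : ℝ, Tendsto (fun n : ℕ => prob n p (fun G => PhiC3 G)) atTop (𝓝 L)) ∧
    ((p : ℝ) < (√5 - 1) / 2 →
      Tendsto (fun n : ℕ => prob n p (fun G => ¬ PhiI1 G ∧ ¬ PhiI2 G ∧ ¬ PhiI3 G)) atTop (𝓝 1)) ∧
    ((√5 - 1) / 2 < (p : ℝ) →
      Tendsto (fun n : ℕ => prob n p (fun G => PhiI1 G)) atTop (𝓝 1)) ∧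
    ((p : ℝ) = (√5 - 1) / 2 →
      ¬ ∃ L : ℝ, Tendsto (fun n : ℕ => prob n p (fun G => PhiI3 G)) atTop (𝓝 L)) := by
  have hσ : (unitInterval.symm p : ℝ) = 1 - p := unitInterval.coe_symm_eq p
  have hσ0 : 0 < (unitInterval.symm p : ℝ) := by linarith
  have hσ1 : (unitInterval.symm p : ℝ) < 1 := by linarith
  simp only [← phiC1_compl, ← phiC2_compl, ← phiC3_compl, prob_compl _ p PhiC1,
    prob_compl _ p PhiC3, prob_compl _ p fun G => ¬ PhiC1 G ∧ ¬ PhiC2 G ∧ ¬ PhiC3 G]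
  refine ⟨fun h => ?_, fun h => ?_, fun h => ?_, fun h => ?_, fun h => ?_, fun h => ?_⟩
  · exact tendsto_prob_not_phiC hp0 hp1 ((threshold_lt_iff hp1).1 h)
  · exact tendsto_prob_phiC1 hp0 hp1 ((lt_threshold_iff hp1).1 h)
  · exact not_tendsto_prob_phiC3 hp0 hp1 ((eq_threshold_iff hp1).1 h)
  · exact tendsto_prob_not_phiC hσ0 hσ1 ((threshold_lt_iff hσ1).1 (by linarith))
  · exact tendsto_prob_phiC1 hσ0 hσ1 ((lt_threshold_iff hσ1).1 (by linarith))
  · exact not_tendsto_prob_phiC3 hσ0 hσ1 ((eq_threshold_iff hσ1).1 (by linarith))
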